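/- Let $n\ge 1$ and let $\lambda$ be a Young diagram with fewer than $n$ rows and $|\lambda|$ boxes. Let $\mathrm{SST}_n(\lambda)$ be the set of semistandard tableaux of shape $\lambda$ with entries in $\{1,\dots,n\}$, and for $T\in\mathrm{SST}_n(\lambda)$ let $\mathrm{cont}(T)=(c_1,\dots,c_n)$, where $c_k$ is the number of entries of $T$ equal to $k$. Let $\mathrm{pr}$ be the promotion operator on $\mathrm{SST}_n(\lambda)$: replace every entry $n$ by a dot, slide the dots to the northwest corner by jeu de taquin, from left to right, then replace the dots by $1$ and increase all other entries by $1$. For $1\le i\le n-1$ let $\tilde s_i$ be the simple reflection on the $U_q(\mathfrak{sl}_n)$-crystal $\mathrm{SST}_n(\lambda)$, i.e. $\tilde s_i(T)=\tilde f_i^{\,k}T$ if $k:=c_i-c_{i+1}\ge 0$ and $\tilde s_i(T)=\tilde e_i^{\,-k}T$ if $k<0$, where $\tilde e_i,\tilde f_i$ are the crystal operators, and let $\tilde c=\tilde s_1\tilde s_2\cdots\tilde s_{n-1}$. Assume that $\gcd(n,|\lambda|)=1$ and that $\tilde s_i\circ\mathrm{pr}^n=\mathrm{pr}^n\circ\tilde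 s_i$ for all $1\le i\le n-1$. Then the following hold. (1) For every $T\in\mathrm{SST}_n(\lambda)$, $$\bigl|\{\mathrm{pr}^k(T) : k\in\mathbb Z_{\ge0}\}\bigr|=\bigl|\{\tilde c^{\,a}\,\mathrm{pr}^{bn}(T) : a,b\in\mathbb Z_{\ge0}\}\bigr| .$$ (2) For $\alpha\in\mathbb Z_{\ge0}^n$ that is the content of some tableau in $\mathrm{SST}_n(\lambda)$, let $\mathfrak o_\lambda(\alpha)$ be the order of the restriction of $\mathrm{pr}^n$ to $\{T\in\mathrm{SST}_n(\lambda):\mathrm{cont}(T)=\alpha\}$, and let $\mathrm{cont}^+(\lambda)$ be the set of those $\alpha=(a_1,\dots,a_n)$ among these contents with $a_1\ge a_2\ge\cdots\ge a_n$. Then the order of $\mathrm{pr}$ on $\mathrm{SST}_n(\lambda)$ equals $$n\cdot\operatorname{lcm}\{\mathfrak o_\lambda(\alpha) : \alpha\in\mathrm{cont}^+(\lambda)\}.$$ -/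

import Mathlib

/-! ## Semistandard tableaux with entries in `{1, …, n}` -/

/-- `SST n μ` is the set of semistandard tableaux of shape `μ` with entries in `{1, …, n}`
(positions outside the diagram hold the value `0`). Rows and columns are numbered from `0`. -/
def SST (n : ℕ) (μ : YoungDiagram) : Type :=
  {T : SemistandardYoungTableau μ // ∀ i j, (i, j) ∈ μ → 1 ≤ T i j ∧ T i j ≤ n}

namespace SST

/-- The entry of `T` in row `i` and column `j`. -/
def entry {n : ℕ} {μ : YoungDiagram} (T : SST n μ) : ℕ → ℕ → ℕ := T.1.entry

/-- A semistandard tableau is determined by its entries. -/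
theorem ext_entry {n : ℕ} {μ : YoungDiagram} {T T' : SST n μ}
    (h : ∀ i j, (i, j) ∈ μ → T.entry i j = T'.entry i j) : T = T' := by
  apply Subtype.ext
  apply SemistandardYoungTableau.ext
  intro i j
  by_cases hc : (i, j) ∈ μ
  · exact h i j hc
  · rw [T.1.zeros hc, T'.1.zeros hc]

instance instFinite (n : ℕ) (μ : YoungDiagram) : Finite (SST n μ) := by
  have hinj : Function.Injective (fun (T : SST n μ) (c : μ.cells) =>
      (⟨T.entry c.1.1 c.1.2, by
        have h := (T.2 c.1.1 c.1.2 ((YoungDiagram.mem_cells _).1 c.2)).2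
        exact Nat.lt_succ_of_le h⟩ : Fin (n + 1))) := by
    intro T T' h
    apply ext_entry
    intro i j hc
    have h1 := congrFun h ⟨(i, j), (YoungDiagram.mem_cells _).2 hc⟩
    exact congrArg Fin.val h1
  exact Finite.of_injective _ hinj

noncomputable instance instFintype (n : ℕ) (μ : YoungDiagram) : Fintype (SST n μ) :=
  Fintype.ofFinite _

/-- The content `(c₁, …, cₙ)` of `T`: the component with index `k : Fin n` is the number of
occurrences of the letter `k + 1` in `T`. -/
def cont {n : ℕ} {μ : YoungDiagram} (T : SST n μ) : Fin n → ℕ := fun k =>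
  (μ.cells.filter (fun c => T.entry c.1 c.2 = (k : ℕ) + 1)).card

end SST

/-! ## Promotion by jeu de taquin -/

namespace Promotion

/-- Replace the entry of the filling `F` in position `(i, j)` by `v`. -/
def put (F : ℕ → ℕ → ℕ) (i j v : ℕ) : ℕ → ℕ → ℕ :=
  fun r c => if r = i ∧ c = j then v else F r c

/-- `slide i j F` replaces the entry of `F` in position `(i, j)` by a dot and slides this dot to the
northwest by jeu de taquin. Dots that have come to rest are recorded as `0`. As long as there is a
letter above or to the left of the moving dot, the dot is exchanged with the larger of these
letters, and with the upper one if they are equal; when there is none, the dot stays.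
(The entry of `F` at the current position of the dot is never read.) -/
def slide : ℕ → ℕ → (ℕ → ℕ → ℕ) → (ℕ → ℕ → ℕ)
  | 0, 0, F => put F 0 0 0
  | 0, j + 1, F =>
      if F 0 j = 0 then put F 0 (j + 1) 0
      else slide 0 j (put F 0 (j + 1) (F 0 j))
  | i + 1, 0, F =>
      if F i 0 = 0 then put F (i + 1) 0 0
      else slide i 0 (put F (i + 1) 0 (F i 0))
  | i + 1, j + 1, F =>
      if F i (j + 1) = 0 ∧ F (i + 1) j = 0 then put F (i + 1) (j + 1) 0
      else if F (i + 1) j ≤ F i (j + 1) then slide i (j + 1) (put F (i + 1) (j + 1) (F i (j + 1)))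
      else slide (i + 1) j (put F (i + 1) (j + 1) (F (i + 1) j))
termination_by i j => i + j

/-- The filling obtained from `T` after the letters `n` in its first `q` columns have been replaced
by dots and slid to the northwest, one after the other from left to right. (A column contains at
most one `n`, at its bottom. A slide that starts in a column does not look at later columns, so
it makes no difference whether the letters `n` there are already marked as dots.) -/
def slideCols (μ : YoungDiagram) (n : ℕ) (T : ℕ → ℕ → ℕ) : ℕ → (ℕ → ℕ → ℕ)
  | 0 => T
  | q + 1 =>
      if T (μ.colLen q - 1) q = n then slide (μ.colLen q - 1) q (slideCols μ n T q)
      else slideCols μ n T q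

/-- The filling underlying the promotion of `T`: slide all dots, then replace the dots by `1` and
increase all other entries by `1`. -/
def fill (μ : YoungDiagram) (n : ℕ) (T : ℕ → ℕ → ℕ) : ℕ → ℕ → ℕ :=
  fun r c => if (r, c) ∈ μ then slideCols μ n T (μ.rowLen 0) r c + 1 else 0

theorem put_same (F : ℕ → ℕ → ℕ) (i j v : ℕ) : put F i j v i j = v := by simp [put]

theorem put_ne (F : ℕ → ℕ → ℕ) {i j r c : ℕ} (v : ℕ) (h : ¬ (r = i ∧ c = j)) :
    put F i j v r c = F r c := by simp [put, h]

/-- Invariant of a slide: `F` is semistandard away from the moving dot at `(i, j)`, its resting dots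
(zeros) are the first `l 0` boxes of the top row, the letters in the columns up to `Q` are
smaller than `N`, and the moving dot stays to the right of the path (encoded by `l`) of the
previous one. -/
structure HoleInv (μ : YoungDiagram) (N Q i j : ℕ) (l : ℕ → ℕ) (F : ℕ → ℕ → ℕ) : Prop where
  mem : (i, j) ∈ μ
  colQ : j ≤ Q
  row : ∀ r c c', c < c' → (r, c') ∈ μ → ¬ (r = i ∧ c = j) → ¬ (r = i ∧ c' = j) → F r c ≤ F r c'
  col : ∀ r r' c, r < r' → (r', c) ∈ μ → ¬ (r = i ∧ c = j) → ¬ (r' = i ∧ c = j) → F r c < F r' c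
  pos : ∀ r c, (r + 1, c) ∈ μ → ¬ (r + 1 = i ∧ c = j) → 0 < F (r + 1) c
  lt : ∀ r c, (r, c) ∈ μ → c ≤ Q → ¬ (r = i ∧ c = j) → F r c < N
  zero : ∀ c, (0, c) ∈ μ → ¬ (0 = i ∧ c = j) → (F 0 c = 0 ↔ c < l 0)
  mono : ∀ r s, r ≤ s → s ≤ i → l r ≤ l s
  le : l i ≤ j
  bar : ∀ r m, r < i → l (r + 1) = m + 1 → (r + 1, m + 1) ∈ μ → F (r + 1) m ≤ F r (m + 1)

/-- The state after a completed slide from row `i` in column `Q`. -/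
structure DoneInv (μ : YoungDiagram) (N Q i j : ℕ) (l : ℕ → ℕ) (F : ℕ → ℕ → ℕ) : Prop where
  row : ∀ r c c', c < c' → (r, c') ∈ μ → F r c ≤ F r c'
  col : ∀ r r' c, r < r' → (r', c) ∈ μ → F r c < F r' c
  lt : ∀ r c, (r, c) ∈ μ → c ≤ Q → F r c < N
  zero : ∀ c, (0, c) ∈ μ → (F 0 c = 0 ↔ c < l 0)
  mono : ∀ r s, r ≤ s → s ≤ i → l r ≤ l s
  le : l i ≤ j + 1
  bar : ∀ r m, r < i → l (r + 1) = m + 1 → (r + 1, m + 1) ∈ μ → F (r + 1) m ≤ F r (m + 1)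

theorem HoleInv.up {μ : YoungDiagram} {N Q i j : ℕ} {l : ℕ → ℕ} {F : ℕ → ℕ → ℕ}
    (h : HoleInv μ N Q (i + 1) j l F) (h0 : F i j ≠ 0)
    (hle : ∀ m, j = m + 1 → F (i + 1) m ≤ F i j) :
    HoleInv μ N Q i j l (put F (i + 1) j (F i j)) where
  mem := μ.up_left_mem (Nat.le_succ i) le_rfl h.mem
  colQ := h.colQ
  row := by
    intro r c c' hcc hm h1 h2
    by_cases hr : r = i + 1
    · subst hr
      by_cases hc : c = j
      · subst hc
        rw [put_same, put_ne _ _ (by omega)]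
        have hm' : (i, c') ∈ μ := μ.up_left_mem (Nat.le_succ i) le_rfl hm
        have a1 := h.row i c c' hcc hm' (by omega) (by omega)
        have a2 := h.col i (i + 1) c' (by omega) hm (by omega) (by omega)
        omega
      · by_cases hc' : c' = j
        · subst hc'
          rw [put_same, put_ne _ _ (by omega)]
          obtain ⟨m, rfl⟩ : ∃ m, c' = m + 1 := ⟨c' - 1, by omega⟩
          have a1 := hle m rfl
          rcases Nat.lt_or_ge c m with hcm | hcm
          · have hm' : (i + 1, m) ∈ μ := μ.up_left_mem le_rfl (Nat.le_succ m) hm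
            have a2 := h.row (i + 1) c m hcm hm' (by omega) (by omega)
            omega
          · have : c = m := by omega
            subst this
            exact a1
        · rw [put_ne _ _ (by omega), put_ne _ _ (by omega)]
          exact h.row _ _ _ hcc hm (by omega) (by omega)
    · rw [put_ne _ _ (by omega), put_ne _ _ (by omega)]
      exact h.row _ _ _ hcc hm (by omega) (by omega)
  col := by
    intro r r' c hrr hm h1 h2
    by_cases hc : c = j
    · subst hc
      by_cases hr : r = i + 1
      · subst hr
        rw [put_same, put_ne _ _ (by omega)]
        exact h.col i r' c (by omega) hm (by omega) (by omega)
      · by_cases hr' : r' = i + 1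
        · subst hr'
          rw [put_same, put_ne _ _ (by omega)]
          exact h.col r i c (by omega) (μ.up_left_mem (Nat.le_succ i) le_rfl hm)
            (by omega) (by omega)
        · rw [put_ne _ _ (by omega), put_ne _ _ (by omega)]
          exact h.col _ _ _ hrr hm (by omega) (by omega)
    · rw [put_ne _ _ (by omega), put_ne _ _ (by omega)]
      exact h.col _ _ _ hrr hm (by omega) (by omega)
  pos := by
    intro r c hm h1
    by_cases hc : r + 1 = i + 1 ∧ c = j
    · obtain ⟨h3, rfl⟩ := hc
      rw [h3, put_same]
      omega
    · rw [put_ne _ _ hc]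
      exact h.pos r c hm hc
  lt := by
    intro r c hm hq h1
    by_cases hc : r = i + 1 ∧ c = j
    · obtain ⟨rfl, rfl⟩ := hc
      rw [put_same]
      exact h.lt i c (μ.up_left_mem (Nat.le_succ i) le_rfl hm) hq (by omega)
    · rw [put_ne _ _ hc]
      exact h.lt r c hm hq hc
  zero := by
    intro c hm h1
    rw [put_ne _ _ (by omega)]
    exact h.zero c hm (by omega)
  mono := fun r s h1 h2 => h.mono r s h1 (by omega)
  le := le_trans (h.mono i (i + 1) (by omega) le_rfl) h.le
  bar := by
    intro r m hr hl hm
    rw [put_ne _ _ (by omega), put_ne _ _ (by omega)]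
    exact h.bar r m (by omega) hl hm

theorem HoleInv.left {μ : YoungDiagram} {N Q i j : ℕ} {l : ℕ → ℕ} {F : ℕ → ℕ → ℕ}
    (h : HoleInv μ N Q i (j + 1) l F) (h0 : F i j ≠ 0)
    (hle : ∀ m, i = m + 1 → F m (j + 1) < F i j) :
    HoleInv μ N Q i j l (put F i (j + 1) (F i j)) where
  mem := μ.up_left_mem le_rfl (Nat.le_succ j) h.mem
  colQ := le_trans (Nat.le_succ j) h.colQ
  row := by
    intro r c c' hcc hm h1 h2
    by_cases hr : r = i
    · subst hr
      by_cases hc : c = j + 1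
      · subst hc
        rw [put_same, put_ne _ _ (by omega)]
        exact h.row r j c' (by omega) hm (by omega) (by omega)
      · by_cases hc' : c' = j + 1
        · subst hc'
          rw [put_same, put_ne _ _ (by omega)]
          exact h.row r c j (by omega) (μ.up_left_mem le_rfl (Nat.le_succ j) hm)
            (by omega) (by omega)
        · rw [put_ne _ _ (by omega), put_ne _ _ (by omega)]
          exact h.row _ _ _ hcc hm (by omega) (by omega)
    · rw [put_ne _ _ (by omega), put_ne _ _ (by omega)]
      exact h.row _ _ _ hcc hm (by omega) (by omega)
  col := by
    intro r r' c hrr hm h1 h2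
    by_cases hc : c = j + 1
    · subst hc
      by_cases hr : r = i
      · subst hr
        rw [put_same, put_ne _ _ (by omega)]
        have hm' : (r', j) ∈ μ := μ.up_left_mem le_rfl (Nat.le_succ j) hm
        have a1 := h.col r r' j hrr hm' (by omega) (by omega)
        have a2 := h.row r' j (j + 1) (by omega) hm (by omega) (by omega)
        omega
      · by_cases hr' : r' = i
        · subst hr'
          rw [put_same, put_ne _ _ (by omega)]
          obtain ⟨m, rfl⟩ : ∃ m, r' = m + 1 := ⟨r' - 1, by omega⟩
          have a1 := hle m rfl
          rcases Nat.lt_or_ge r m with hcm | hcm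
          · have hm' : (m, j + 1) ∈ μ := μ.up_left_mem (Nat.le_succ m) le_rfl hm
            have a2 := h.col r m (j + 1) hcm hm' (by omega) (by omega)
            omega
          · have : r = m := by omega
            subst this
            exact a1
        · rw [put_ne _ _ (by omega), put_ne _ _ (by omega)]
          exact h.col _ _ _ hrr hm (by omega) (by omega)
    · rw [put_ne _ _ (by omega), put_ne _ _ (by omega)]
      exact h.col _ _ _ hrr hm (by omega) (by omega)
  pos := by
    intro r c hm h1
    by_cases hc : r + 1 = i ∧ c = j + 1
    · obtain ⟨rfl, rfl⟩ := hc
      rw [put_same]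
      omega
    · rw [put_ne _ _ hc]
      exact h.pos r c hm hc
  lt := by
    intro r c hm hq h1
    by_cases hc : r = i ∧ c = j + 1
    · obtain ⟨rfl, rfl⟩ := hc
      rw [put_same]
      exact h.lt r j (μ.up_left_mem le_rfl (Nat.le_succ j) hm) (by omega) (by omega)
    · rw [put_ne _ _ hc]
      exact h.lt r c hm hq hc
  zero := by
    intro c hm h1
    by_cases hc : 0 = i ∧ c = j + 1
    · obtain ⟨rfl, rfl⟩ := hc
      rw [put_same]
      have := h.le
      constructor <;> intro h3 <;> omega
    · rw [put_ne _ _ hc]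
      exact h.zero c hm hc
  mono := h.mono
  le := by
    have h1 := h.le
    by_contra h2
    have h3 : l i = j + 1 := by omega
    cases i with
    | zero =>
      have h4 := (h.zero j (μ.up_left_mem le_rfl (Nat.le_succ j) h.mem) (by omega)).2 (by omega)
      exact h0 h4
    | succ m =>
      have h4 := h.bar m j (by omega) h3 h.mem
      have h5 := hle m rfl
      omega
  bar := by
    intro r m hr hl hm
    have h1 := h.mono (r + 1) i (by omega) le_rfl
    have h2 := h.le
    rw [put_ne _ _ (by omega), put_ne _ _ (by omega)]
    exact h.bar r m (by omega) hl hm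

theorem HoleInv.halt {μ : YoungDiagram} {N Q i j : ℕ} {l : ℕ → ℕ} {F : ℕ → ℕ → ℕ}
    (h : HoleInv μ N Q i j l F) (hN : 0 < N) (hu : ∀ m, i = m + 1 → F m j = 0)
    (hl : ∀ m, j = m + 1 → F i m = 0) :
    ∃ l', DoneInv μ N Q i j l' (put F i j 0) := by
  have hi : i = 0 := by
    by_contra hi
    obtain ⟨m, rfl⟩ : ∃ m, i = m + 1 := ⟨i - 1, by omega⟩
    have h1 := hu m rfl
    have hm : (m, j) ∈ μ := μ.up_left_mem (Nat.le_succ m) le_rfl h.mem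
    cases m with
    | zero =>
      have h2 := (h.zero j hm (by omega)).1 h1
      have h3 := h.mono 0 1 (by omega) le_rfl
      have h4 := h.le
      simp only [zero_add] at h4
      omega
    | succ k =>
      have := h.pos k j hm (by omega)
      omega
  subst hi
  refine ⟨fun _ => j + 1, ?_, ?_, ?_, ?_, ?_, ?_, ?_⟩
  · intro r c c' hcc hm
    by_cases h1 : r = 0 ∧ c = j
    · obtain ⟨rfl, rfl⟩ := h1
      rw [put_same]
      exact Nat.zero_le _
    · by_cases h2 : r = 0 ∧ c' = j
      · obtain ⟨rfl, rfl⟩ := h2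
        rw [put_ne _ _ h1]
        obtain ⟨m, rfl⟩ : ∃ m, c' = m + 1 := ⟨c' - 1, by omega⟩
        have a1 := hl m rfl
        rcases Nat.lt_or_ge c m with hcm | hcm
        · have a2 := h.row 0 c m hcm (μ.up_left_mem le_rfl (Nat.le_succ m) hm)
            (by omega) (by omega)
          omega
        · have : c = m := by omega
          subst this
          omega
      · rw [put_ne _ _ h1, put_ne _ _ h2]
        exact h.row _ _ _ hcc hm h1 h2
  · intro r r' c hrr hm
    rw [put_ne (r := r') _ _ (by omega)]
    by_cases h1 : r = 0 ∧ c = j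
    · obtain ⟨rfl, rfl⟩ := h1
      rw [put_same]
      obtain ⟨m, rfl⟩ : ∃ m, r' = m + 1 := ⟨r' - 1, by omega⟩
      exact h.pos m c hm (by omega)
    · rw [put_ne _ _ h1]
      exact h.col _ _ _ hrr hm h1 (by omega)
  · intro r c hm hq
    by_cases h1 : r = 0 ∧ c = j
    · obtain ⟨rfl, rfl⟩ := h1
      rwa [put_same]
    · rw [put_ne _ _ h1]
      exact h.lt r c hm hq h1
  · intro c hm
    by_cases h1 : c = j
    · subst h1
      rw [put_same]
      simp
    · rw [put_ne _ _ (by omega)]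
      rcases Nat.lt_or_ge c j with h2 | h2
      · obtain ⟨m, rfl⟩ : ∃ m, j = m + 1 := ⟨j - 1, by omega⟩
        have a1 := hl m rfl
        have a2 : F 0 c ≤ F 0 m := by
          rcases Nat.lt_or_ge c m with hcm | hcm
          · exact h.row 0 c m hcm (μ.up_left_mem le_rfl (Nat.le_succ m) h.mem)
              (by omega) (by omega)
          · have : c = m := by omega
            subst this
            exact le_rfl
        constructor <;> intro <;> omega
      · have a1 := h.zero c hm (by omega)
        have a2 := h.le
        constructor
        · intro h3
          have := a1.1 h3
          omega
        · intro h3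
          omega
  · intros
    exact le_rfl
  · exact le_rfl
  · intro r m hr
    omega

/-- A slide started at `(i, j)` only changes entries weakly northwest of `(i, j)`. -/
theorem slide_of_lt (i j : ℕ) (F : ℕ → ℕ → ℕ) {r c : ℕ} (h : i < r ∨ j < c) :
    slide i j F r c = F r c := by
  induction i, j, F using slide.induct with
  | case1 F => rw [slide, put_ne _ _ (by omega)]
  | case2 j F h0 => rw [slide, if_pos h0, put_ne _ _ (by omega)]
  | case3 j F h0 ih => rw [slide, if_neg h0, ih (by omega), put_ne _ _ (by omega)]
  | case4 i F h0 => rw [slide, if_pos h0, put_ne _ _ (by omega)]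
  | case5 i F h0 ih => rw [slide, if_neg h0, ih (by omega), put_ne _ _ (by omega)]
  | case6 i j F h0 => rw [slide, if_pos h0, put_ne _ _ (by omega)]
  | case7 i j F h0 h1 ih =>
    rw [slide, if_neg h0, if_pos h1, ih (by omega), put_ne _ _ (by omega)]
  | case8 i j F h0 h1 ih =>
    rw [slide, if_neg h0, if_neg h1, ih (by omega), put_ne _ _ (by omega)]

theorem extend {μ : YoungDiagram} {N Q i j : ℕ} {l : ℕ → ℕ} {G : ℕ → ℕ → ℕ}
    (h : DoneInv μ N Q i j l G) (hb : (i + 1, j + 1) ∈ μ → G (i + 1) j ≤ G i (j + 1)) :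
    ∃ l', DoneInv μ N Q (i + 1) j l' G := by
  refine ⟨fun r => if r ≤ i then l r else j + 1, h.row, h.col, h.lt, ?_, ?_, ?_, ?_⟩
  · intro c hm
    simpa using h.zero c hm
  · intro r s hrs hs
    have h1 := h.le
    split_ifs with h2 h3 h3
    · exact h.mono r s hrs h3
    · exact le_trans (h.mono r i h2 le_rfl) h1
    · omega
    · exact le_rfl
  · simp
  · intro r m hr hl hm
    by_cases h1 : r + 1 ≤ i
    · simp only [h1, if_true] at hl
      exact h.bar r m (by omega) hl hm
    · have : r = i := by omega
      subst this
      simp only [h1, if_false] at hl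
      have : m = j := by omega
      subst this
      exact hb hm

theorem slide_done {μ : YoungDiagram} {N Q : ℕ} (hN : 0 < N) (i j : ℕ) (F : ℕ → ℕ → ℕ)
    (l : ℕ → ℕ) (h : HoleInv μ N Q i j l F) : ∃ l', DoneInv μ N Q i j l' (slide i j F) := by
  have upb : ∀ (i j : ℕ) (F : ℕ → ℕ → ℕ), HoleInv μ N Q (i + 1) j l F →
      (i + 1, j + 1) ∈ μ →
      slide i j (put F (i + 1) j (F i j)) (i + 1) j ≤
        slide i j (put F (i + 1) j (F i j)) i (j + 1) := by
    intro i j F h hm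
    rw [slide_of_lt _ _ _ (by omega), slide_of_lt _ _ _ (by omega), put_same,
      put_ne _ _ (by omega)]
    exact h.row i j (j + 1) (by omega) (μ.up_left_mem (Nat.le_succ i) le_rfl hm)
      (by omega) (by omega)
  induction i, j, F using slide.induct with
  | case1 F =>
    rw [slide]
    exact h.halt hN (by omega) (by omega)
  | case2 j F h0 =>
    rw [slide, if_pos h0]
    refine h.halt hN (by omega) ?_
    intro m hm
    obtain rfl : j = m := by omega
    exact h0
  | case3 j F h0 ih =>
    rw [slide, if_neg h0]
    obtain ⟨l', h'⟩ := ih (h.left h0 (by omega))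
    exact ⟨l', h'.row, h'.col, h'.lt, h'.zero, h'.mono, le_trans h'.le (by omega), h'.bar⟩
  | case4 i F h0 =>
    rw [slide, if_pos h0]
    refine h.halt hN ?_ (by omega)
    intro m hm
    obtain rfl : i = m := by omega
    exact h0
  | case5 i F h0 ih =>
    rw [slide, if_neg h0]
    obtain ⟨l', h'⟩ := ih (h.up h0 (by omega))
    exact extend h' (upb i 0 F h)
  | case6 i j F h0 =>
    rw [slide, if_pos h0]
    refine h.halt hN ?_ ?_
    · intro m hm
      obtain rfl : i = m := by omega
      exact h0.1
    · intro m hm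
      obtain rfl : j = m := by omega
      exact h0.2
  | case7 i j F h0 h1 ih =>
    rw [slide, if_neg h0, if_pos h1]
    have h2 : F i (j + 1) ≠ 0 := by omega
    obtain ⟨l', h'⟩ := ih (h.up h2 (by
      intro m hm
      obtain rfl : j = m := by omega
      exact h1))
    exact extend h' (upb i (j + 1) F h)
  | case8 i j F h0 h1 ih =>
    rw [slide, if_neg h0, if_neg h1]
    have h2 : F (i + 1) j ≠ 0 := by omega
    have h3 : F i (j + 1) < F (i + 1) j := by omega
    obtain ⟨l', h'⟩ := ih (h.left h2 (by
      intro m hm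
      obtain rfl : i = m := by omega
      exact h3))
    exact ⟨l', h'.row, h'.col, h'.lt, h'.zero, h'.mono, le_trans h'.le (by omega), h'.bar⟩

/-- The state after the first `q` columns have been treated. -/
structure ColsInv (μ : YoungDiagram) (n q : ℕ) (T F : ℕ → ℕ → ℕ) (l : ℕ → ℕ) : Prop where
  row : ∀ r c c', c < c' → (r, c') ∈ μ → F r c ≤ F r c'
  col : ∀ r r' c, r < r' → (r', c) ∈ μ → F r c < F r' c
  lt : ∀ r c, (r, c) ∈ μ → c < q → F r c < n
  same : ∀ r c, q ≤ c → F r c = T r c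
  zero : ∀ c, (0, c) ∈ μ → (F 0 c = 0 ↔ c < l 0)
  mono : ∀ r s, r ≤ s → (s, q) ∈ μ → l r ≤ l s
  le : ∀ r, (r, q) ∈ μ → l r ≤ q
  bar : ∀ r m, (r + 1, q) ∈ μ → l (r + 1) = m + 1 → (r + 1, m + 1) ∈ μ → F (r + 1) m ≤ F r (m + 1)

theorem slideCols_inv {n : ℕ} {μ : YoungDiagram} (T : SST n μ) (q : ℕ) (hq : q ≤ μ.rowLen 0) :
    ∃ l, ColsInv μ n q T.entry (slideCols μ n T.entry q) l := by
  induction q with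
  | zero =>
    refine ⟨fun _ => 0, ?_, ?_, ?_, ?_, ?_, ?_, ?_, ?_⟩
    · intro r c c' h hm
      exact T.1.row_weak h hm
    · intro r r' c h hm
      exact T.1.col_strict h hm
    · intro r c _ h
      omega
    · intros
      rfl
    · intro c hm
      have h1 := (T.2 0 c hm).1
      have h2 : slideCols μ n T.entry 0 0 c = T.1 0 c := rfl
      rw [h2]
      omega
    · intros
      exact le_rfl
    · intros
      exact Nat.zero_le _
    · intro r m _ h
      omega
  | succ q ih =>
    obtain ⟨l, h⟩ := ih (by omega)
    have h0 : (0, q) ∈ μ := YoungDiagram.mem_iff_lt_rowLen.2 (by omega)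
    have hc0 : 0 < μ.colLen q := YoungDiagram.mem_iff_lt_colLen.1 h0
    have hmem : (μ.colLen q - 1, q) ∈ μ := YoungDiagram.mem_iff_lt_colLen.2 (by omega)
    have hbot : ∀ r, (r, q) ∈ μ → r ≤ μ.colLen q - 1 := by
      intro r hr
      have := YoungDiagram.mem_iff_lt_colLen.1 hr
      omega
    have hprev : ∀ r, (r, q + 1) ∈ μ → (r, q) ∈ μ := fun r hr =>
      μ.up_left_mem le_rfl (Nat.le_succ q) hr
    have hnb : T.entry (μ.colLen q - 1) q ≤ n := (T.2 _ _ hmem).2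
    have hT : ∀ r r', r ≤ r' → (r', q) ∈ μ → T.entry r q ≤ T.entry r' q := by
      intro r r' hr hm
      exact T.1.col_weak hr hm
    have hTs : ∀ r r', r < r' → (r', q) ∈ μ → T.entry r q < T.entry r' q := by
      intro r r' hr hm
      exact T.1.col_strict hr hm
    have hpos : ∀ r c, (r, c) ∈ μ → 1 ≤ T.entry r c := fun r c hm => (T.2 r c hm).1
    by_cases hn : T.entry (μ.colLen q - 1) q = n
    · have hN : 0 < n := by
        have := hpos _ _ hmem
        omega
      have hole : HoleInv μ n q (μ.colLen q - 1) q l (slideCols μ n T.entry q) := by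
        refine ⟨hmem, le_rfl, ?_, ?_, ?_, ?_, ?_, ?_, ?_, ?_⟩
        · intro r c c' h1 h2 _ _
          exact h.row r c c' h1 h2
        · intro r r' c h1 h2 _ _
          exact h.col r r' c h1 h2
        · intro r c h1 _
          exact lt_of_le_of_lt (Nat.zero_le _) (h.col 0 (r + 1) c (by omega) h1)
        · intro r c h1 h2 h3
          rcases Nat.lt_or_ge c q with h4 | h4
          · exact h.lt r c h1 h4
          · obtain rfl : c = q := by omega
            rw [h.same r c le_rfl]
            have h5 := hbot r h1
            have h6 := hTs r (μ.colLen c - 1) (by omega) hmem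
            omega
        · intro c h1 _
          exact h.zero c h1
        · intro r s h1 h2
          exact h.mono r s h1 (μ.up_left_mem h2 le_rfl hmem)
        · exact h.le _ hmem
        · intro r m h1 h2 h3
          exact h.bar r m (μ.up_left_mem (by omega) le_rfl hmem) h2 h3
      obtain ⟨l', h'⟩ := slide_done hN _ _ _ _ hole
      have heq : slideCols μ n T.entry (q + 1) =
          slide (μ.colLen q - 1) q (slideCols μ n T.entry q) := by
        rw [slideCols, if_pos hn]
      rw [heq]
      refine ⟨l', h'.row, h'.col, ?_, ?_, h'.zero, ?_, ?_, ?_⟩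
      · intro r c h1 h2
        exact h'.lt r c h1 (by omega)
      · intro r c h1
        rw [slide_of_lt _ _ _ (by omega)]
        exact h.same r c (by omega)
      · intro r s h1 h2
        exact h'.mono r s h1 (hbot s (hprev s h2))
      · intro r h1
        exact le_trans (h'.mono r _ (hbot r (hprev r h1)) le_rfl) h'.le
      · intro r m h1 h2 h3
        exact h'.bar r m (by have := hbot _ (hprev _ h1); omega) h2 h3
    · have heq : slideCols μ n T.entry (q + 1) = slideCols μ n T.entry q := by
        rw [slideCols, if_neg hn]
      rw [heq]
      refine ⟨l, h.row, h.col, ?_, ?_, h.zero, ?_, ?_, ?_⟩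
      · intro r c h1 h2
        rcases Nat.lt_or_ge c q with h4 | h4
        · exact h.lt r c h1 h4
        · obtain rfl : c = q := by omega
          rw [h.same r c le_rfl]
          have h6 := hT r (μ.colLen c - 1) (hbot r h1) hmem
          omega
      · intro r c h1
        exact h.same r c (by omega)
      · intro r s h1 h2
        exact h.mono r s h1 (hprev s h2)
      · intro r h1
        exact le_trans (h.le r (hprev r h1)) (Nat.le_succ q)
      · intro r m h1 h2 h3
        exact h.bar r m (hprev _ h1) h2 h3

end Promotion

namespace SST

/-- The promotion operator `pr` on `SST n μ`. -/
def pr {n : ℕ} {μ : YoungDiagram} (T : SST n μ) : SST n μ :=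
  ⟨{ entry := Promotion.fill μ n T.entry
     row_weak' := by
       intro i j1 j2 hj hm
       obtain ⟨l, h⟩ := Promotion.slideCols_inv T (μ.rowLen 0) le_rfl
       have hm' : (i, j1) ∈ μ := μ.up_left_mem le_rfl hj.le hm
       have := h.row i j1 j2 hj hm
       simp only [Promotion.fill, hm, hm', if_true]
       omega
     col_strict' := by
       intro i1 i2 j hi hm
       obtain ⟨l, h⟩ := Promotion.slideCols_inv T (μ.rowLen 0) le_rfl
       have hm' : (i1, j) ∈ μ := μ.up_left_mem hi.le le_rfl hm
       have := h.col i1 i2 j hi hm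
       simp only [Promotion.fill, hm, hm', if_true]
       omega
     zeros' := by
       intro i j hm
       simp only [Promotion.fill, hm, if_false] },
   by
     intro i j hm
     obtain ⟨l, h⟩ := Promotion.slideCols_inv T (μ.rowLen 0) le_rfl
     have hm' : (0, j) ∈ μ := μ.up_left_mem (Nat.zero_le i) le_rfl hm
     have h1 := h.lt i j hm (YoungDiagram.mem_iff_lt_rowLen.1 hm')
     have h2 : Promotion.fill μ n T.entry i j =
         Promotion.slideCols μ n T.entry (μ.rowLen 0) i j + 1 := by
       simp only [Promotion.fill, hm, if_true]
     change 1 ≤ Promotion.fill μ n T.entry i j ∧ Promotion.fill μ n T.entry i j ≤ n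
     omega⟩

end SST

/-! ## The crystal structure on tableaux -/

/-- The crystal of words of type `A`: a word `x₁x₂⋯` stands for `x₁ ⊗ x₂ ⊗ ⋯` in a tensor power of
the crystal `1 → 2 → ⋯ → n` of the vector representation, with the tensor product rule
`f̃ᵢ(b₁ ⊗ b₂) = f̃ᵢ b₁ ⊗ b₂` if `φᵢ(b₁) > εᵢ(b₂)` and `b₁ ⊗ f̃ᵢ b₂` otherwise,
`ẽᵢ(b₁ ⊗ b₂) = ẽᵢ b₁ ⊗ b₂` if `φᵢ(b₁) ≥ εᵢ(b₂)` and `b₁ ⊗ ẽᵢ b₂` otherwise,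
`εᵢ(b₁ ⊗ b₂) = max (εᵢ(b₁)) (εᵢ(b₂) - ⟨hᵢ, wt b₁⟩)`.
The zero element is `none`. -/
def wordEps (i : ℕ) : List ℕ → ℕ
  | [] => 0
  | x :: u =>
      if x = i + 1 then wordEps i u + 1
      else if x = i then wordEps i u - 1
      else wordEps i u

/-- The operator `f̃ᵢ` on words. A single letter `x` has `φᵢ(x) = 1` if `x = i`, else `φᵢ(x) = 0`. -/
def wordF (i : ℕ) : List ℕ → Option (List ℕ)
  | [] => none
  | x :: u =>
      if x = i ∧ wordEps i u = 0 then some ((i + 1) :: u)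
      else (wordF i u).map (fun v => x :: v)

/-- The operator `ẽᵢ` on words. -/
def wordE (i : ℕ) : List ℕ → Option (List ℕ)
  | [] => none
  | x :: u =>
      if wordEps i u ≤ (if x = i then 1 else 0) then
        (if x = i + 1 then some (i :: u) else none)
      else (wordE i u).map (fun v => x :: v)

namespace SST

/-- The reading word of a tableau: rows from top to bottom, each row from right to left. -/
def word {n : ℕ} {μ : YoungDiagram} (T : SST n μ) : List ℕ :=
  (List.range (μ.colLen 0)).flatMap
    (fun r => ((List.range (μ.rowLen r)).reverse.map (fun c => T.entry r c)))

open Classical in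
/-- The crystal operator `f̃ᵢ` on tableaux (`none` is the zero element): the reading word embeds the
tableaux of shape `μ` into the crystal of words, and `f̃ᵢ T` is the tableau whose reading word
is `f̃ᵢ` of the reading word of `T`. -/
noncomputable def crystalF {n : ℕ} {μ : YoungDiagram} (i : ℕ) (T : SST n μ) : Option (SST n μ) :=
  if h : ∃ T' : SST n μ, wordF i T.word = some T'.word then some h.choose else none

open Classical in
/-- The crystal operator `ẽᵢ` on tableaux. -/
noncomputable def crystalE {n : ℕ} {μ : YoungDiagram} (i : ℕ) (T : SST n μ) : Option (SST n μ) :=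
  if h : ∃ T' : SST n μ, wordE i T.word = some T'.word then some h.choose else none

/-- The number of occurrences of the letter `v` in `T`. -/
def mult {n : ℕ} {μ : YoungDiagram} (T : SST n μ) (v : ℕ) : ℕ :=
  (μ.cells.filter (fun c => T.entry c.1 c.2 = v)).card

/-- The simple reflection `s̃ᵢ` on tableaux: with `k = ⟨hᵢ, wt T⟩ = cᵢ - cᵢ₊₁`, it sends `T` to
`f̃ᵢ ^ k T` if `k ≥ 0` and to `ẽᵢ ^ (-k) T` if `k < 0`. (In a crystal of a finite-dimensional
module these powers are never zero, so the default value of `getD` is not used for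
`1 ≤ i < n`.) -/
noncomputable def sTilde {n : ℕ} {μ : YoungDiagram} (i : ℕ) (T : SST n μ) : SST n μ :=
  if T.mult (i + 1) ≤ T.mult i then
    ((fun o => Option.bind o (crystalF i))^[T.mult i - T.mult (i + 1)] (some T)).getD T
  else
    ((fun o => Option.bind o (crystalE i))^[T.mult (i + 1) - T.mult i] (some T)).getD T

/-- The operator `c̃ = s̃₁ s̃₂ ⋯ s̃ₙ₋₁` (a composition of maps: `s̃ₙ₋₁` is applied first). -/
noncomputable def cTilde (n : ℕ) (μ : YoungDiagram) : SST n μ → SST n μ :=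
  ((List.range (n - 1)).map (fun k => sTilde (n := n) (μ := μ) (k + 1))).foldr
    (fun s g => s ∘ g) id

/-- The orbit of `T` under promotion. -/
def orbitPr {n : ℕ} {μ : YoungDiagram} (T : SST n μ) : Set (SST n μ) :=
  {T' | ∃ k : ℕ, T' = pr^[k] T}

/-- The orbit of `T` under `C × P`, where `C` is generated by `c̃` and `P` by `prⁿ`. -/
def orbitCP {n : ℕ} {μ : YoungDiagram} (T : SST n μ) : Set (SST n μ) :=
  {T' | ∃ a b : ℕ, T' = (cTilde n μ)^[a] (pr^[b * n] T)}

/-- The set `cont⁺(μ)` of all weakly decreasing contents of tableaux in `SST n μ`. -/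
noncomputable def contPlus (n : ℕ) (μ : YoungDiagram) : Finset (Fin n → ℕ) :=
  open Classical in
  (Finset.univ.image (fun T : SST n μ => T.cont)).filter (fun α => Antitone α)

/-- The order of the restriction of `prⁿ` to the tableaux of shape `μ` and content `α`: the least
positive `k` such that `(prⁿ) ^ k` fixes all these tableaux. -/
noncomputable def orderOn {n : ℕ} (μ : YoungDiagram) (α : Fin n → ℕ) : ℕ :=
  sInf {k : ℕ | 0 < k ∧ ∀ T : SST n μ, T.cont = α → (pr^[n])^[k] T = T}

end SST

/-! ## Strings of words under the crystal operators -/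

/-! Both claims rest on how contents move. Promotion turns the content (c₁, …, cₙ) into (cₙ, c₁, …,
cₙ₋₁). So does `cTilde`, because each s̃ᵢ exchanges cᵢ and cᵢ₊₁. Since n is prime to |λ|, the n
rotations of a content are distinct: a period d properly dividing n would make n/d a common divisor
of n and |λ| (`dvd_of_periodic_of_coprime_sum`). In particular prᵏ T = T forces n ∣ k.

For (1), the promotion orbit of T has n·e elements, where e is the size of its orbit under prⁿ.
Because c̃ⁿ = 1, the other set consists of the c̃ᵃ pr^{bn} T with a < n and b < e. These are
distinct: the content determines a, and injectivity of c̃ then determines b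
(`ncard_orbit_eq_of_rotation`).

For (2), the order is a multiple of n, and the order of prⁿ remains to be found. The involutions s̃ᵢ
commute with prⁿ and can sort any content into weakly decreasing order. So a power of prⁿ is the
identity as soon as it fixes the tableaux with sorted content (`SST.iterate_pr_eq_of_antitone`).

The substance lies in two inputs. First, promotion is injective: each slide can be undone, and the
resting dots show where to start (`SST.pr_injective`). Second, c̃ⁿ = 1, which is formal once the s̃ᵢ
satisfy the Coxeter relations of the symmetric group (`Coxeter.Relations.asc_pow_succ`).

Those relations are proved for words, where s̃ᵢ becomes the reversal of an i-string
(`CrystalWord.reflect`). Involutivity and distant commutation are inductions on the word. For the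
braid relation, the letters i, i+1, i+2 are row inserted. The resulting three-letter tableau and the
record of new boxes determine the word. Reflections keep the record and act on the tableau by
piecewise linear formulas, for which the relation is a finite check (`Pattern.braid`). The results
transfer to tableaux because the crystal operators preserve the set of reading words of a given
shape (`SST.word_sTilde`). -/

namespace CrystalWord

/-- The element `v` with `εᵢ(v) = t` of the `i`-string through the word `w`. -/
def stringAt (i : ℕ) : ℕ → List ℕ → List ℕ
  | _, [] => []
  | t, x :: u =>
      -- Write uₛ for the member of the string of `u` with εᵢ = s. Putting `i` or `i + 1` in front
      -- gives two strings. The long one is i⊗u₀, (i+1)⊗u₀, (i+1)⊗u₁, …; the short one is i⊗u₁,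
      -- i⊗u₂, …. This condition recognises the long one.
      if x = i + 1 ∨ (x = i ∧ wordEps i u = 0) then
        (if t = 0 then i :: stringAt i 0 u else (i + 1) :: stringAt i (t - 1) u)
      else if x = i then i :: stringAt i (t + 1) u
      else x :: stringAt i t u

/-- The value `φᵢ(w)`. -/
def phi (i : ℕ) (w : List ℕ) : ℕ := wordEps i w + w.count i - w.count (i + 1)

/-- The simple reflection on words. -/
def reflect (i : ℕ) (w : List ℕ) : List ℕ := stringAt i (phi i w) w

theorem count_succ_le (i : ℕ) (w : List ℕ) :
    w.count (i + 1) ≤ wordEps i w + w.count i := by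
  induction w with
  | nil => simp
  | cons x u ih =>
    simp only [wordEps, List.count_cons, beq_iff_eq]
    split_ifs <;> omega

theorem stringAt_self (i : ℕ) (w : List ℕ) : stringAt i (wordEps i w) w = w := by
  induction w with
  | nil => rfl
  | cons x u ih =>
    by_cases h1 : x = i + 1
    · subst h1
      simp [stringAt, wordEps, ih]
    · by_cases h2 : x = i
      · subst h2
        by_cases h3 : wordEps x u = 0
        · rw [h3] at ih
          simp [stringAt, wordEps, h3, ih]
        · have h4 : wordEps x u - 1 + 1 = wordEps x u := by omega
          simp [stringAt, wordEps, h3, h4, ih]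
      · simp [stringAt, wordEps, h1, h2, ih]

/-- The bound is the length εᵢ + φᵢ of the string. Each step along it turns one letter `i` into `i +
1`, which gives the two counts. -/
theorem stringAt_spec (i : ℕ) (w : List ℕ) : ∀ t, t ≤ wordEps i w + phi i w →
    wordEps i (stringAt i t w) = t ∧
    (stringAt i t w).count i + t = w.count i + wordEps i w ∧
    (stringAt i t w).count (i + 1) + wordEps i w = w.count (i + 1) + t := by
  induction w with
  | nil =>
    intro t ht
    simp [phi, wordEps] at ht
    simp [stringAt, wordEps, ht]
  | cons x u ih =>
    intro t ht
    have h0 := count_succ_le i u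
    unfold phi at ht ih
    by_cases h1 : x = i + 1
    · subst h1
      simp only [wordEps, List.count_cons, beq_iff_eq, if_true] at ht
      by_cases ht0 : t = 0
      · have := ih 0 (by omega)
        subst ht0
        simp [stringAt, wordEps]
        omega
      · have := ih (t - 1) (by simp at ht; omega)
        simp [stringAt, wordEps, ht0]
        omega
    · by_cases h2 : x = i
      · subst h2
        simp [wordEps] at ht
        by_cases h3 : wordEps x u = 0
        · by_cases ht0 : t = 0
          · have := ih 0 (by omega)
            subst ht0
            simp [stringAt, wordEps, h3]
            omega
          · have := ih (t - 1) (by omega)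
            simp [stringAt, wordEps, h3, ht0]
            omega
        · have := ih (t + 1) (by omega)
          simp [stringAt, wordEps, h3]
          omega
      · simp [wordEps, h1, h2] at ht
        have := ih t ht
        simp [stringAt, wordEps, h1, h2]
        omega

theorem count_stringAt_of_ne (i v : ℕ) (h : v ≠ i) (h' : v ≠ i + 1) (w : List ℕ) :
    ∀ t, (stringAt i t w).count v = w.count v := by
  induction w with
  | nil => intro t; simp [stringAt]
  | cons x u ih =>
    intro t
    simp only [stringAt]
    split_ifs with h1 h2 h3
    · have : x ≠ v := by omega
      simp [ih, this, h.symm]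
    · have : x ≠ v := by omega
      simp [ih, this, h'.symm]
    · simp [List.count_cons, ih, h3]
    · simp [List.count_cons, ih]

theorem phi_stringAt (i : ℕ) (w : List ℕ) (t : ℕ) (ht : t ≤ wordEps i w + phi i w) :
    phi i (stringAt i t w) = wordEps i w + phi i w - t := by
  have h := stringAt_spec i w t ht
  have h0 := count_succ_le i w
  unfold phi at *
  omega

theorem phi_cons (i x : ℕ) (u : List ℕ) : phi i (x :: u) =
    if x = i + 1 then phi i u else if x = i ∧ wordEps i u = 0 then phi i u + 1 else phi i u := by
  have h0 := count_succ_le i u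
  simp only [phi, wordEps, List.count_cons, beq_iff_eq]
  split_ifs <;> omega

theorem wordF_stringAt (i : ℕ) (w : List ℕ) : ∀ t, t + 1 ≤ wordEps i w + phi i w →
    wordF i (stringAt i t w) = some (stringAt i (t + 1) w) := by
  induction w with
  | nil =>
    intro t ht
    simp [phi, wordEps] at ht
  | cons x u ih =>
    intro t ht
    rw [phi_cons] at ht
    simp only [wordEps] at ht
    by_cases h1 : x = i + 1 ∨ (x = i ∧ wordEps i u = 0)
    · have ht' : t ≤ wordEps i u + phi i u := by
        split_ifs at ht <;> omega
      simp only [stringAt, h1, if_true]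
      by_cases ht0 : t = 0
      · have h2 := (stringAt_spec i u 0 (by omega)).1
        subst ht0
        simp [wordF, h2]
      · have h2 := ih (t - 1) (by omega)
        have h3 : t - 1 + 1 = t := by omega
        simp [wordF, h2, h3, ht0]
    · by_cases h2 : x = i
      · have h3 := (stringAt_spec i u (t + 1) (by split_ifs at ht <;> omega)).1
        have h4 := ih (t + 1) (by split_ifs at ht <;> omega)
        subst h2
        have h5 : wordEps x u ≠ 0 := by omega
        simp [stringAt, wordF, h5, h3, h4]
      · have h4 := ih t (by split_ifs at ht <;> omega)
        have h6 : ¬ x = i + 1 := by omega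
        simp [stringAt, wordF, h6, h2, h4]

theorem wordE_stringAt (i : ℕ) (w : List ℕ) : ∀ t, t + 1 ≤ wordEps i w + phi i w →
    wordE i (stringAt i (t + 1) w) = some (stringAt i t w) := by
  induction w with
  | nil =>
    intro t ht
    simp [phi, wordEps] at ht
  | cons x u ih =>
    intro t ht
    rw [phi_cons] at ht
    simp only [wordEps] at ht
    by_cases h1 : x = i + 1 ∨ (x = i ∧ wordEps i u = 0)
    · have ht' : t ≤ wordEps i u + phi i u := by
        split_ifs at ht <;> omega
      have h2 := (stringAt_spec i u t ht').1
      simp only [stringAt, h1, if_true]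
      by_cases ht0 : t = 0
      · subst ht0
        simp [wordE, h2]
      · have h4 := ih (t - 1) (by omega)
        have h3 : t - 1 + 1 = t := by omega
        rw [h3] at h4
        simp [wordE, h2, ht0, h4]
    · by_cases h2 : x = i
      · have h3 := (stringAt_spec i u (t + 1 + 1) (by split_ifs at ht <;> omega)).1
        have h4 := ih (t + 1) (by split_ifs at ht <;> omega)
        subst h2
        have h5 : wordEps x u ≠ 0 := by omega
        simp [stringAt, wordE, h5, h3, h4]
      · have h3 := (stringAt_spec i u (t + 1) (by split_ifs at ht <;> omega)).1
        have h4 := ih t (by split_ifs at ht <;> omega)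
        have h6 : ¬ x = i + 1 := by omega
        simp [stringAt, wordE, h6, h2, h3, h4]

/-- All members of a string generate the same string, so only the last parameter matters. Together
with `stringAt_self` this makes the reflection an involution. -/
theorem stringAt_stringAt (i : ℕ) (w : List ℕ) : ∀ s t, t ≤ wordEps i w + phi i w →
    stringAt i s (stringAt i t w) = stringAt i s w := by
  induction w with
  | nil => intros; rfl
  | cons x u ih =>
    intro s t ht
    rw [phi_cons] at ht
    simp only [wordEps] at ht
    by_cases h1 : x = i + 1 ∨ (x = i ∧ wordEps i u = 0)
    · simp only [stringAt, h1, if_true]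
      have ht' : t ≤ wordEps i u + phi i u + 1 := by
        split_ifs at ht <;> omega
      by_cases ht0 : t = 0
      · have h2 := (stringAt_spec i u 0 (by omega)).1
        subst ht0
        simp [stringAt, h2, ih _ 0]
      · simp [stringAt, ht0, ih _ (t - 1) (show t - 1 ≤ wordEps i u + phi i u by omega)]
    · by_cases h2 : x = i
      · have h3 := (stringAt_spec i u (t + 1) (by split_ifs at ht <;> omega)).1
        have h4 := ih (s + 1) (t + 1) (by split_ifs at ht <;> omega)
        subst h2
        have h5 : wordEps x u ≠ 0 := by omega
        simp [stringAt, h5, h3, h4]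
      · have h6 : ¬ x = i + 1 := by omega
        simp [stringAt, h6, h2, ih s t (by split_ifs at ht <;> omega)]

theorem reflect_reflect (i : ℕ) (w : List ℕ) : reflect i (reflect i w) = w := by
  have h : phi i w ≤ wordEps i w + phi i w := by omega
  unfold reflect
  rw [phi_stringAt i w _ h, stringAt_stringAt i w _ _ h, Nat.add_sub_cancel, stringAt_self]

theorem count_reflect_self (i : ℕ) (w : List ℕ) : (reflect i w).count i = w.count (i + 1) := by
  have h := stringAt_spec i w (phi i w) (by omega)
  have h0 := count_succ_le i w
  unfold reflect phi at *
  omega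

theorem count_reflect_succ (i : ℕ) (w : List ℕ) : (reflect i w).count (i + 1) = w.count i := by
  have h := stringAt_spec i w (phi i w) (by omega)
  have h0 := count_succ_le i w
  unfold reflect phi at *
  omega

theorem count_reflect_of_ne (i v : ℕ) (h : v ≠ i) (h' : v ≠ i + 1) (w : List ℕ) :
    (reflect i w).count v = w.count v := count_stringAt_of_ne i v h h' w _

theorem iterate_wordF (i : ℕ) (w : List ℕ) (k : ℕ) (hk : k ≤ phi i w) :
    (fun o => Option.bind o (wordF i))^[k] (some w) = some (stringAt i (wordEps i w + k) w) := by
  induction k with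
  | zero => simp [stringAt_self]
  | succ k ih =>
    rw [Function.iterate_succ_apply', ih (by omega), Option.bind_some,
      wordF_stringAt i w _ (by omega), Nat.add_assoc]

theorem iterate_wordE (i : ℕ) (w : List ℕ) (k : ℕ) (hk : k ≤ wordEps i w) :
    (fun o => Option.bind o (wordE i))^[k] (some w) = some (stringAt i (wordEps i w - k) w) := by
  induction k with
  | zero => simp [stringAt_self]
  | succ k ih =>
    have h : wordEps i w - k = wordEps i w - (k + 1) + 1 := by omega
    rw [Function.iterate_succ_apply', ih (by omega), Option.bind_some, h,
      wordE_stringAt i w _ (by omega)]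

theorem iterate_wordF_eq_reflect (i : ℕ) (w : List ℕ) (h : w.count (i + 1) ≤ w.count i) :
    (fun o => Option.bind o (wordF i))^[w.count i - w.count (i + 1)] (some w) =
      some (reflect i w) := by
  rw [iterate_wordF i w _ (by unfold phi; omega), reflect]
  congr 2
  unfold phi
  omega

theorem iterate_wordE_eq_reflect (i : ℕ) (w : List ℕ) (h : w.count i ≤ w.count (i + 1)) :
    (fun o => Option.bind o (wordE i))^[w.count (i + 1) - w.count i] (some w) =
      some (reflect i w) := by
  have h0 := count_succ_le i w
  rw [iterate_wordE i w _ (by omega), reflect]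
  congr 2
  unfold phi
  omega

theorem wordEps_stringAt_of_lt {i j : ℕ} (h : i + 1 < j ∨ j + 1 < i) (w : List ℕ) :
    ∀ t, wordEps j (stringAt i t w) = wordEps j w := by
  induction w with
  | nil => intro t; rfl
  | cons x u ih =>
    intro t
    have e1 : ¬ i = j := by omega
    have e2 : ¬ i = j + 1 := by omega
    have e3 : ¬ i + 1 = j := by omega
    simp only [stringAt]
    split_ifs with h1 h2 h3
    · have f1 : ¬ x = j := by omega
      have f2 : ¬ x = j + 1 := by omega
      simp [wordEps, ih, e1, e2, f1, f2]
    · have f1 : ¬ x = j := by omega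
      have f2 : ¬ x = j + 1 := by omega
      simp [wordEps, ih, e1, e3, f1, f2]
    · simp [wordEps, ih, h3]
    · simp [wordEps, ih]

/-- The pairs {i, i+1} and {j, j+1} are disjoint, so each operator only moves letters that the other
one skips. -/
theorem stringAt_comm {i j : ℕ} (h : i + 1 < j ∨ j + 1 < i) (w : List ℕ) :
    ∀ s t, stringAt i s (stringAt j t w) = stringAt j t (stringAt i s w) := by
  induction w with
  | nil => intros; rfl
  | cons x u ih =>
    intro s t
    have e1 := wordEps_stringAt_of_lt h u
    have e2 := wordEps_stringAt_of_lt h.symm u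
    have a1 : ¬ i = j := by omega
    have a2 : ¬ i = j + 1 := by omega
    have a3 : ¬ i + 1 = j := by omega
    have b1 : ¬ j = i := by omega
    have b2 : ¬ j = i + 1 := by omega
    have b3 : ¬ j + 1 = i := by omega
    by_cases hi : x = i ∨ x = i + 1
    · have f1 : ¬ x = j := by omega
      have f2 : ¬ x = j + 1 := by omega
      by_cases h1 : x = i + 1 ∨ (x = i ∧ wordEps i u = 0)
      · by_cases hs : s = 0 <;> simp [stringAt, h1, f1, f2, e2, hs, ih, a1, a2, a3]
      · by_cases h2 : x = i
        · have h3 : ¬ wordEps i u = 0 := by omega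
          subst h2
          simp [stringAt, h3, e2, ih, a1, a2]
        · omega
    · have g1 : ¬ x = i := by omega
      have g2 : ¬ x = i + 1 := by omega
      by_cases h1 : x = j + 1 ∨ (x = j ∧ wordEps j u = 0)
      · by_cases hs : t = 0 <;> simp [stringAt, h1, g1, g2, e1, hs, ih, b1, b2, b3]
      · by_cases h2 : x = j
        · have h3 : ¬ wordEps j u = 0 := by omega
          subst h2
          simp [stringAt, h3, e1, ih, b1, b2]
        · have h3 : ¬ x = j + 1 := by omega
          simp [stringAt, h3, h2, g1, g2, ih]

theorem reflect_comm {i j : ℕ} (h : i + 1 < j ∨ j + 1 < i) (w : List ℕ) :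
    reflect i (reflect j w) = reflect j (reflect i w) := by
  have p1 : ∀ t, phi i (stringAt j t w) = phi i w := by
    intro t
    unfold phi
    rw [wordEps_stringAt_of_lt h.symm, count_stringAt_of_ne _ _ (by omega) (by omega),
      count_stringAt_of_ne _ _ (by omega) (by omega)]
  have p2 : ∀ t, phi j (stringAt i t w) = phi j w := by
    intro t
    unfold phi
    rw [wordEps_stringAt_of_lt h, count_stringAt_of_ne _ _ (by omega) (by omega),
      count_stringAt_of_ne _ _ (by omega) (by omega)]
  unfold reflect
  rw [p1, p2, stringAt_comm h]

end CrystalWord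

/-! ## Three-letter patterns and the braid relation -/

/-- The numbers of letters in the rows of a semistandard tableau with three letters:
`rjk` is the number of letters `k` in row `j`. -/
@[ext]
structure Pattern where
  r11 : ℕ
  r12 : ℕ
  r13 : ℕ
  r22 : ℕ
  r23 : ℕ
  r33 : ℕ

namespace Pattern

/-- The inequalities which make the rows into a semistandard tableau. -/
structure Valid (T : Pattern) : Prop where
  le1 : T.r22 ≤ T.r11
  le2 : T.r22 + T.r23 ≤ T.r11 + T.r12
  le3 : T.r33 ≤ T.r22

/-- The function `ε₁`. -/
def eps1 (T : Pattern) : ℕ := T.r12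

/-- The function `φ₁`. -/
def phi1 (T : Pattern) : ℕ := T.r11 - T.r22

/-- The function `ε₂`. -/
def eps2 (T : Pattern) : ℕ := T.r13 + (T.r23 - T.r12)

/-- The function `φ₂`. -/
def phi2 (T : Pattern) : ℕ := (T.r12 - T.r23) + (T.r22 - T.r33)

/-- The element with `ε₁ = t` of the `1`-string. -/
def string1 (t : ℕ) (T : Pattern) : Pattern :=
  ⟨T.r11 + T.r12 - t, t, T.r13, T.r22, T.r23, T.r33⟩

/-- The element with `ε₂ = t` of the `2`-string. -/
def string2 (t : ℕ) (T : Pattern) : Pattern :=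
  -- In the bracketing rule, min(r12, r23) letters 2 of row 1 are matched with letters 3 of row 2,
  -- and r33 letters 2 of row 2 with the 3s of row 3. Matched letters are frozen. Row 1 keeps r13 +
  -- (r12 - r23) free letters; of the `t` free 3s, as many as possible go there and the rest into
  -- row 2.
  ⟨T.r11, min T.r12 T.r23 + (T.r13 + (T.r12 - T.r23) - t), min t (T.r13 + (T.r12 - T.r23)),
    T.r33 + ((T.r23 - T.r12) + (T.r22 - T.r33) - (t - (T.r13 + (T.r12 - T.r23)))),
    min T.r12 T.r23 + (t - (T.r13 + (T.r12 - T.r23))), T.r33⟩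

/-- Row insertion of the smallest letter. -/
def insert1 (T : Pattern) : Pattern :=
  ⟨T.r11 + 1, T.r12 - 1, T.r13 - (1 - T.r12), T.r22 + min T.r12 1,
    T.r23 - min T.r12 1 + min T.r13 (1 - T.r12), T.r33 + min T.r23 (min T.r12 1)⟩

/-- The row in which the insertion of the smallest letter ends. -/
def row1 (T : Pattern) : ℕ :=
  min T.r12 1 + min T.r13 (1 - T.r12) + min T.r23 (min T.r12 1)

/-- Row insertion of the middle letter. -/
def insert2 (T : Pattern) : Pattern :=
  ⟨T.r11, T.r12 + 1, T.r13 - 1, T.r22, T.r23 + min T.r13 1, T.r33⟩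

/-- The row in which the insertion of the middle letter ends. -/
def row2 (T : Pattern) : ℕ := min T.r13 1

/-- Row insertion of the largest letter, which ends in the first row. -/
def insert3 (T : Pattern) : Pattern :=
  ⟨T.r11, T.r12, T.r13 + 1, T.r22, T.r23, T.r33⟩

theorem Valid.insert1 {T : Pattern} (h : T.Valid) : T.insert1.Valid := by
  obtain ⟨h1, h2, h3⟩ := h
  constructor <;> simp only [Pattern.insert1] <;> omega

theorem Valid.insert2 {T : Pattern} (h : T.Valid) : T.insert2.Valid := by
  obtain ⟨h1, h2, h3⟩ := h
  constructor <;> simp only [Pattern.insert2] <;> omega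

theorem Valid.insert3 {T : Pattern} (h : T.Valid) : T.insert3.Valid := by
  obtain ⟨h1, h2, h3⟩ := h
  constructor <;> simp only [Pattern.insert3] <;> omega

/-- The reflection is described by row sums, by the new number of 3s, and by the invariance of the
matched pairs, min(b', e') = min(b, e). The final disjunction spells out this last equation in
linear terms. -/
theorem string2_phi2 {a b c d e f : ℕ} (h1 : d ≤ a) (h2 : d + e ≤ a + b) (h3 : f ≤ d) :
    ∃ b' c' d' e', string2 (phi2 ⟨a, b, c, d, e, f⟩) ⟨a, b, c, d, e, f⟩ = ⟨a, b', c', d', e', f⟩ ∧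
      b' + c' = b + c ∧ d' + e' = d + e ∧ c' + e' + f = b + d ∧ f ≤ d' ∧ d' ≤ a ∧
      d' + e' ≤ a + b' ∧
      ((b ≤ e ∧ b' = b ∧ b ≤ e' ∨ b ≤ e ∧ e' = b ∧ b ≤ b') ∨
        (e ≤ b ∧ b' = e ∧ e ≤ e' ∨ e ≤ b ∧ e' = e ∧ e ≤ b')) := by
  refine ⟨_, _, _, _, rfl, ?_⟩
  simp only [phi2]
  rcases le_total b e with k | k
  · have e1 : b - e = 0 := by omega
    simp only [min_eq_left k, e1]
    refine ⟨?_, ?_, ?_, ?_, ?_, ?_, ?_⟩ <;> omega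
  · have e1 : e - b = 0 := by omega
    simp only [min_eq_right k, e1]
    refine ⟨?_, ?_, ?_, ?_, ?_, ?_, ?_⟩ <;> omega

theorem string1_phi1 {a b c d e f : ℕ} (h : d ≤ a) :
    ∃ a' b', string1 (phi1 ⟨a, b, c, d, e, f⟩) ⟨a, b, c, d, e, f⟩ = ⟨a', b', c, d, e, f⟩ ∧
      b' + d = a ∧ a' = b + d := by
  refine ⟨_, _, rfl, ?_, ?_⟩ <;> simp only [phi1] <;> omega

set_option maxHeartbeats 4000000 in
theorem braid {T : Pattern} (h : T.Valid) :
    string1 (string2 (string1 T.phi1 T).phi2 (string1 T.phi1 T)).phi1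
        (string2 (string1 T.phi1 T).phi2 (string1 T.phi1 T)) =
      string2 (string1 (string2 T.phi2 T).phi1 (string2 T.phi2 T)).phi2
        (string1 (string2 T.phi2 T).phi1 (string2 T.phi2 T)) := by
  obtain ⟨h1, h2, h3⟩ := h
  obtain ⟨a, b, c, d, e, f⟩ := T
  simp only at h1 h2 h3
  obtain ⟨b1, c1, d1, e1, q, q1, q2, q3, q4, q5, q6, q7⟩ := string2_phi2 (c := c) h1 h2 h3
  obtain ⟨a2, b2, p, p1, p2⟩ := string1_phi1 (b := b1) (c := c1) (e := e1) (f := f) q5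
  obtain ⟨b3, c3, d3, e3, r, r1, r2, r3, r4, r5, r6, r7⟩ :=
    string2_phi2 (a := a2) (b := b2) (c := c1) (d := d1) (e := e1) (f := f)
      (by omega) (by omega) (by omega)
  obtain ⟨a4, b4, s, s1, s2⟩ := string1_phi1 (b := b) (c := c) (e := e) (f := f) h1
  obtain ⟨b5, c5, d5, e5, t, t1, t2, t3, t4, t5, t6, t7⟩ :=
    string2_phi2 (a := a4) (b := b4) (c := c) (d := d) (e := e) (f := f)
      (by omega) (by omega) (by omega)
  obtain ⟨a6, b6, u, u1, u2⟩ := string1_phi1 (b := b5) (c := c5) (e := e5) (f := f) t5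
  rw [q, p, r, s, t, u]
  clear q p r s t u
  -- Only one coordinate needs the equations between minima, and it is settled case by case. The
  -- others then follow from the linear relations alone.
  have hd : d5 = d3 := by
    rcases q7 with (⟨_, _, _⟩ | ⟨_, _, _⟩) | (⟨_, _, _⟩ | ⟨_, _, _⟩) <;>
    rcases r7 with (⟨_, _, _⟩ | ⟨_, _, _⟩) | (⟨_, _, _⟩ | ⟨_, _, _⟩) <;>
    rcases t7 with (⟨_, _, _⟩ | ⟨_, _, _⟩) | (⟨_, _, _⟩ | ⟨_, _, _⟩) <;> omega
  clear q7 r7 t7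
  have g1 : b6 = b3 := by omega
  have g2 : c5 = c3 := by omega
  have g3 : e5 = e3 := by omega
  have g4 : a6 = a2 := by omega
  rw [g1, g2, g3, g4, hd]

end Pattern

/-! ### Row insertion of three letters is reversible when the row of the new box is known. -/

namespace Pattern

theorem insert1_spec (T : Pattern) :
    (T.row1 = 0 ∧ T.r12 = 0 ∧ T.r13 = 0 ∧
      T.insert1 = ⟨T.r11 + 1, 0, 0, T.r22, T.r23, T.r33⟩) ∨
    (T.row1 = 1 ∧ T.r12 = 0 ∧ 0 < T.r13 ∧
      T.insert1 = ⟨T.r11 + 1, 0, T.r13 - 1, T.r22, T.r23 + 1, T.r33⟩) ∨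
    (T.row1 = 1 ∧ 0 < T.r12 ∧ T.r23 = 0 ∧
      T.insert1 = ⟨T.r11 + 1, T.r12 - 1, T.r13, T.r22 + 1, 0, T.r33⟩) ∨
    (T.row1 = 2 ∧ 0 < T.r12 ∧ 0 < T.r23 ∧
      T.insert1 = ⟨T.r11 + 1, T.r12 - 1, T.r13, T.r22 + 1, T.r23 - 1, T.r33 + 1⟩) := by
  obtain ⟨a, b, c, d, e, f⟩ := T
  simp only [insert1, row1, mk.injEq]
  rcases b with _ | b <;> rcases c with _ | c <;> rcases e with _ | e <;> simp

theorem insert2_spec (T : Pattern) :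
    (T.row2 = 0 ∧ T.r13 = 0 ∧ T.insert2 = ⟨T.r11, T.r12 + 1, 0, T.r22, T.r23, T.r33⟩) ∨
    (T.row2 = 1 ∧ 0 < T.r13 ∧
      T.insert2 = ⟨T.r11, T.r12 + 1, T.r13 - 1, T.r22, T.r23 + 1, T.r33⟩) := by
  obtain ⟨a, b, c, d, e, f⟩ := T
  simp only [insert2, row2, mk.injEq]
  rcases c with _ | c <;> simp

theorem insert1_inj {T T' : Pattern} (h : T.insert1 = T'.insert1)
    (hr : T.row1 = T'.row1) : T = T' := by
  rcases insert1_spec T with ⟨a1, a2, a3, a4⟩ | ⟨a1, a2, a3, a4⟩ | ⟨a1, a2, a3, a4⟩ |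
    ⟨a1, a2, a3, a4⟩ <;> rcases insert1_spec T' with ⟨b1, b2, b3, b4⟩ | ⟨b1, b2, b3, b4⟩ |
    ⟨b1, b2, b3, b4⟩ | ⟨b1, b2, b3, b4⟩ <;> rw [a4, b4, mk.injEq] at h <;>
    first
    | exact absurd h (by omega)
    | ext <;> omega

theorem insert2_inj {T T' : Pattern} (h : T.insert2 = T'.insert2)
    (hr : T.row2 = T'.row2) : T = T' := by
  rcases insert2_spec T with ⟨a1, a2, a4⟩ | ⟨a1, a2, a4⟩ <;>
    rcases insert2_spec T' with ⟨b1, b2, b4⟩ | ⟨b1, b2, b4⟩ <;> rw [a4, b4, mk.injEq] at h <;>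
    first
    | exact absurd h (by omega)
    | ext <;> omega

theorem insert3_inj {T T' : Pattern} (h : T.insert3 = T'.insert3) : T = T' := by
  simp only [insert3, mk.injEq] at h
  ext <;> omega

theorem insert1_ne_insert2 {T T' : Pattern} (hT' : T'.Valid)
    (hr : T.row1 = T'.row2) : T.insert1 ≠ T'.insert2 := by
  intro h
  obtain ⟨k1, k2, k3⟩ := hT'
  rcases insert1_spec T with ⟨a1, a2, a3, a4⟩ | ⟨a1, a2, a3, a4⟩ | ⟨a1, a2, a3, a4⟩ |
    ⟨a1, a2, a3, a4⟩ <;> rcases insert2_spec T' with ⟨b1, b2, b4⟩ | ⟨b1, b2, b4⟩ <;>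
    rw [a4, b4, mk.injEq] at h <;> omega

theorem insert1_ne_insert3 {T T' : Pattern} (hr : T.row1 = 0) : T.insert1 ≠ T'.insert3 := by
  intro h
  rcases insert1_spec T with ⟨a1, a2, a3, a4⟩ | ⟨a1, a2, a3, a4⟩ | ⟨a1, a2, a3, a4⟩ |
    ⟨a1, a2, a3, a4⟩ <;> rw [a4, insert3, mk.injEq] at h <;> omega

theorem insert2_ne_insert3 {T T' : Pattern} (hr : T.row2 = 0) : T.insert2 ≠ T'.insert3 := by
  intro h
  rcases insert2_spec T with ⟨b1, b2, b4⟩ | ⟨b1, b2, b4⟩ <;>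
    rw [b4, insert3, mk.injEq] at h <;> omega

end Pattern

namespace CrystalWord
open Pattern

/-- The pattern of the letters `i`, `i + 1`, `i + 2` of a word, by row insertion from its end. -/
def pattern (i : ℕ) : List ℕ → Pattern
  | [] => ⟨0, 0, 0, 0, 0, 0⟩
  | x :: u =>
      if x = i then (pattern i u).insert1
      else if x = i + 1 then (pattern i u).insert2
      else if x = i + 2 then (pattern i u).insert3
      else pattern i u

/-- The recording sequence of the insertions; letters other than `i`, `i + 1`, `i + 2` are
recorded as they are. -/
def record (i : ℕ) : List ℕ → List (ℕ × Bool)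
  | [] => []
  | x :: u =>
      (if x = i then ((pattern i u).row1, true)
      else if x = i + 1 then ((pattern i u).row2, true)
      else if x = i + 2 then (0, true)
      else (x, false)) :: record i u

theorem pattern_valid (i : ℕ) (w : List ℕ) : (pattern i w).Valid := by
  induction w with
  | nil => constructor <;> simp [pattern]
  | cons x u ih =>
    simp only [pattern]
    split_ifs
    exacts [ih.insert1, ih.insert2, ih.insert3, ih]

/-- This is the injectivity of Schensted insertion: the final pattern and the row of the last new
box determine the inserted letter and the previous pattern. The Boolean in the record separates
genuine insertions from letters that are merely copied. -/
theorem eq_of_pattern_eq {i : ℕ} {w w' : List ℕ} (h : pattern i w = pattern i w')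
    (hr : record i w = record i w') : w = w' := by
  induction w generalizing w' with
  | nil =>
    cases w' with
    | nil => rfl
    | cons x u => simp [record] at hr
  | cons x u ih =>
    cases w' with
    | nil => simp [record] at hr
    | cons y v =>
      simp only [record, List.cons.injEq] at hr
      obtain ⟨hr1, hr2⟩ := hr
      simp only [pattern] at h
      have hu := pattern_valid i u
      have hv := pattern_valid i v
      split_ifs at h hr1 with h1 h2 h3 h4 h5 h6 h7 h8 h9 <;>
        simp only [Prod.mk.injEq, and_true, reduceCtorEq, and_false] at hr1
      · rw [ih (insert1_inj h hr1) hr2, h1, h2]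
      · exact absurd h (insert1_ne_insert2 hv hr1)
      · exact absurd h (insert1_ne_insert3 hr1)
      · exact absurd h.symm (insert1_ne_insert2 hu hr1.symm)
      · obtain rfl : x = y := by omega
        rw [ih (insert2_inj h hr1) hr2]
      · exact absurd h (insert2_ne_insert3 hr1)
      · exact absurd h.symm (insert1_ne_insert3 hr1.symm)
      · exact absurd h.symm (insert2_ne_insert3 hr1.symm)
      · obtain rfl : x = y := by omega
        rw [ih (insert3_inj h) hr2]
      · rw [ih h hr2, hr1]

end CrystalWord

/-! ### Row insertion is compatible with the strings of patterns. -/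

namespace Pattern

theorem eps1_insert1 (T : Pattern) : T.insert1.eps1 = T.eps1 - 1 := rfl

theorem phi1_insert1 {T : Pattern} (h : T.Valid) :
    T.insert1.phi1 = if T.eps1 = 0 then T.phi1 + 1 else T.phi1 := by
  have h1 := h.le1
  by_cases h0 : T.r12 = 0
  · rw [if_pos (show T.eps1 = 0 from h0)]
    simp only [insert1, phi1]
    omega
  · rw [if_neg (show ¬ T.eps1 = 0 from h0)]
    simp only [insert1, phi1]
    omega

theorem eps1_insert2 (T : Pattern) : T.insert2.eps1 = T.eps1 + 1 := rfl

theorem phi1_insert2 (T : Pattern) : T.insert2.phi1 = T.phi1 := rfl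

theorem eps1_insert3 (T : Pattern) : T.insert3.eps1 = T.eps1 := rfl

theorem phi1_insert3 (T : Pattern) : T.insert3.phi1 = T.phi1 := rfl

theorem eps2_insert1 (T : Pattern) : T.insert1.eps2 = T.eps2 := by
  rcases insert1_spec T with ⟨a1, a2, a3, a4⟩ | ⟨a1, a2, a3, a4⟩ | ⟨a1, a2, a3, a4⟩ |
    ⟨a1, a2, a3, a4⟩ <;> rw [a4] <;> simp only [eps2] <;> omega

theorem phi2_insert1 {T : Pattern} (h : T.Valid) : T.insert1.phi2 = T.phi2 := by
  have h3 := h.le3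
  rcases insert1_spec T with ⟨a1, a2, a3, a4⟩ | ⟨a1, a2, a3, a4⟩ | ⟨a1, a2, a3, a4⟩ |
    ⟨a1, a2, a3, a4⟩ <;> rw [a4] <;> simp only [phi2] <;> omega

theorem eps2_insert2 (T : Pattern) : T.insert2.eps2 = T.eps2 - 1 := by
  rcases insert2_spec T with ⟨a1, a2, a4⟩ | ⟨a1, a2, a4⟩ <;> rw [a4] <;>
    simp only [eps2] <;> omega

theorem phi2_insert2 (T : Pattern) :
    T.insert2.phi2 = if T.eps2 = 0 then T.phi2 + 1 else T.phi2 := by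
  by_cases h0 : T.eps2 = 0
  · rw [if_pos h0]
    simp only [insert2, phi2, eps2] at h0 ⊢
    omega
  · rw [if_neg h0]
    simp only [insert2, phi2, eps2] at h0 ⊢
    omega

theorem eps2_insert3 (T : Pattern) : T.insert3.eps2 = T.eps2 + 1 := by
  simp only [insert3, eps2]
  omega

theorem phi2_insert3 (T : Pattern) : T.insert3.phi2 = T.phi2 := rfl

theorem string1_insert3 (T : Pattern) (t : ℕ) :
    string1 t T.insert3 = (string1 t T).insert3 := rfl

/-- This and the next four lemmas match the branches of `stringAt` for a letter `i` or `i + 1`: the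
parameter shifts in the same way, the inserted letter changes in the same way, and the new box stays
in its row. -/
theorem string1_insert1_of_pos {T : Pattern} {t : ℕ} (ht : t ≤ T.insert1.eps1 + T.insert1.phi1)
    (h : T.eps1 ≠ 0) : string1 t T.insert1 = (string1 (t + 1) T).insert1 ∧
      T.row1 = (string1 (t + 1) T).row1 := by
  obtain ⟨a, b, c, d, e, f⟩ := T
  simp only [eps1, phi1, insert1, string1, row1] at *
  have h1 : min b 1 = 1 := by omega
  have h2 : min (t + 1) 1 = 1 := by omega
  have h3 : 1 - b = 0 := by omega
  have h4 : 1 - (t + 1) = 0 := by omega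
  simp only [h1, h2, h3, h4]
  refine ⟨Pattern.ext ?_ ?_ ?_ ?_ ?_ ?_, ?_⟩ <;> dsimp only <;> omega

theorem string1_insert1_of_zero {T : Pattern} {t : ℕ} (h : T.eps1 = 0) :
    string1 (t + 1) T.insert1 = (string1 t T).insert2 ∧ T.row1 = (string1 t T).row2 := by
  obtain ⟨a, b, c, d, e, f⟩ := T
  simp only [eps1] at h
  subst h
  simp only [insert1, string1, row1, insert2, row2, Nat.zero_min, Nat.sub_zero, Nat.min_zero]
  refine ⟨Pattern.ext ?_ ?_ ?_ ?_ ?_ ?_, ?_⟩ <;> (try simp only) <;> omega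

theorem string1_zero_insert1 {T : Pattern} (h : T.eps1 = 0) :
    string1 0 T.insert1 = (string1 0 T).insert1 ∧ T.row1 = (string1 0 T).row1 := by
  obtain ⟨a, b, c, d, e, f⟩ := T
  simp only [eps1] at h
  subst h
  simp [string1, insert1, row1]

theorem string1_zero_insert2 (T : Pattern) :
    string1 0 T.insert2 = (string1 0 T).insert1 ∧ T.row2 = (string1 0 T).row1 := by
  obtain ⟨a, b, c, d, e, f⟩ := T
  simp [string1, insert1, row1, insert2, row2]
  omega

theorem string1_succ_insert2 (T : Pattern) (t : ℕ) :
    string1 (t + 1) T.insert2 = (string1 t T).insert2 ∧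
      T.row2 = (string1 t T).row2 := by
  obtain ⟨a, b, c, d, e, f⟩ := T
  simp [string1, insert2, row2]
  omega

/-- A description of `string2` by linear equations. -/
theorem string2_spec {T : Pattern} (h : T.r33 ≤ T.r22) {t : ℕ} (ht : t ≤ T.eps2 + T.phi2) :
    ∃ b c d e, string2 t T = ⟨T.r11, b, c, d, e, T.r33⟩ ∧
      b + c = T.r12 + T.r13 ∧ d + e = T.r22 + T.r23 ∧
      (e ≤ b ∧ c = t ∧ (e = T.r12 ∧ T.r12 ≤ T.r23 ∨ e = T.r23 ∧ T.r23 ≤ T.r12) ∨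
        b ≤ e ∧ c + e = t + b ∧ (b = T.r12 ∧ T.r12 ≤ T.r23 ∨ b = T.r23 ∧ T.r23 ≤ T.r12)) := by
  refine ⟨_, _, _, _, rfl, ?_⟩
  simp only [eps2, phi2] at *
  rcases le_total T.r12 T.r23 with k | k
  · have e1 : T.r12 - T.r23 = 0 := by omega
    simp only [min_eq_left k, e1]
    refine ⟨?_, ?_, ?_⟩ <;> omega
  · have e1 : T.r23 - T.r12 = 0 := by omega
    simp only [min_eq_right k, e1]
    refine ⟨?_, ?_, ?_⟩ <;> omega

/-- `string2` is determined by the equations. -/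
theorem eq_string2 {T : Pattern} (h : T.r33 ≤ T.r22) {t : ℕ} (ht : t ≤ T.eps2 + T.phi2)
    {b c d e : ℕ} (h1 : b + c = T.r12 + T.r13) (h2 : d + e = T.r22 + T.r23)
    (h3 : e ≤ b ∧ c = t ∧ (e = T.r12 ∧ T.r12 ≤ T.r23 ∨ e = T.r23 ∧ T.r23 ≤ T.r12) ∨
      b ≤ e ∧ c + e = t + b ∧ (b = T.r12 ∧ T.r12 ≤ T.r23 ∨ b = T.r23 ∧ T.r23 ≤ T.r12)) :
    string2 t T = ⟨T.r11, b, c, d, e, T.r33⟩ := by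
  obtain ⟨b', c', d', e', q, q1, q2, q3⟩ := string2_spec h ht
  rw [q, mk.injEq]
  have hb : b' = b := by
    clear q ht
    omega
  clear q ht
  refine ⟨rfl, ?_, ?_, ?_, ?_, rfl⟩ <;> omega

/-- The smallest letter is inert for the second string, although its insertion bumps letters that
are not. The four shapes of insertion before and after moving along the string are compared. Pairs
ending in different rows are contradictory; for the others the linear characterisation `eq_string2`
applies. -/
theorem string2_insert1 {T : Pattern} (hT : T.Valid) {t : ℕ} (ht : t ≤ T.eps2 + T.phi2) :
    string2 t T.insert1 = (string2 t T).insert1 ∧ T.row1 = (string2 t T).row1 := by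
  have h3 := hT.le3
  have v3 := hT.insert1.le3
  have ht' : t ≤ T.insert1.eps2 + T.insert1.phi2 := by
    rwa [eps2_insert1, phi2_insert1 hT]
  obtain ⟨b, c, d, e, q, q1, q2, q3⟩ := string2_spec h3 ht
  rw [q]
  have hh := insert1_spec T
  have kk := insert1_spec ⟨T.r11, b, c, d, e, T.r33⟩
  clear q
  simp only [eps2, phi2] at ht
  rcases hh with ⟨a1, a2, a3, a4⟩ | ⟨a1, a2, a3, a4⟩ | ⟨a1, a2, a3, a4⟩ |
    ⟨a1, a2, a3, a4⟩ <;> rcases kk with ⟨b1, b2, b3, b4⟩ | ⟨b1, b2, b3, b4⟩ |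
    ⟨b1, b2, b3, b4⟩ | ⟨b1, b2, b3, b4⟩ <;> rw [a1, b1, b4] <;>
    first
    | (exfalso; clear a4 b4 a1 b1 ht' v3; simp only at b2 b3; omega)
    | (refine ⟨?_, rfl⟩
       rw [a4] at ht' v3 ⊢
       clear a4 b4
       apply eq_string2 v3 ht' <;> simp only [true_and] at * <;> omega)

theorem string2_insert2_of_pos {T : Pattern} (hT : T.Valid) {t : ℕ}
    (ht : t + 1 ≤ T.eps2 + T.phi2)
    (h : T.eps2 ≠ 0) : string2 t T.insert2 = (string2 (t + 1) T).insert2 ∧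
      T.row2 = (string2 (t + 1) T).row2 := by
  have h3 := hT.le3
  have v3 := hT.insert2.le3
  have ht' : t ≤ T.insert2.eps2 + T.insert2.phi2 := by
    rw [eps2_insert2, phi2_insert2, if_neg h]
    omega
  obtain ⟨b, c, d, e, q, q1, q2, q3⟩ := string2_spec h3 ht
  rw [q]
  have hh := insert2_spec T
  have kk := insert2_spec ⟨T.r11, b, c, d, e, T.r33⟩
  clear q
  simp only [eps2, phi2] at ht h
  rcases hh with ⟨a1, a2, a4⟩ | ⟨a1, a2, a4⟩ <;> rcases kk with ⟨b1, b2, b4⟩ | ⟨b1, b2, b4⟩ <;>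
    rw [a1, b1, b4] <;>
    first
    | (exfalso; clear a4 b4 a1 b1 ht' v3; simp only at b2; omega)
    | (refine ⟨?_, rfl⟩
       rw [a4] at ht' v3 ⊢
       clear a4 b4
       apply eq_string2 v3 ht' <;> simp only at * <;> omega)

theorem string2_insert2_of_zero {T : Pattern} (hT : T.Valid) {t : ℕ}
    (ht : t ≤ T.eps2 + T.phi2) (h : T.eps2 = 0) :
    string2 (t + 1) T.insert2 = (string2 t T).insert3 ∧ T.row2 = 0 := by
  have h3 := hT.le3
  have v3 := hT.insert2.le3
  have ht' : t + 1 ≤ T.insert2.eps2 + T.insert2.phi2 := by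
    rw [eps2_insert2, phi2_insert2, if_pos h]
    omega
  obtain ⟨b, c, d, e, q, q1, q2, q3⟩ := string2_spec h3 ht
  rw [q]
  clear q
  simp only [eps2, phi2] at ht h
  rcases insert2_spec T with ⟨a1, a2, a4⟩ | ⟨a1, a2, a4⟩
  · refine ⟨?_, a1⟩
    rw [a4] at ht' v3 ⊢
    apply eq_string2 v3 ht' <;> simp only at * <;> omega
  · omega

theorem string2_zero_insert2 {T : Pattern} (hT : T.Valid) (h : T.eps2 = 0) :
    string2 0 T.insert2 = (string2 0 T).insert2 ∧ T.row2 = (string2 0 T).row2 := by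
  obtain ⟨k1, k2, k3⟩ := hT
  obtain ⟨a, b, c, d, e, f⟩ := T
  simp only [eps2] at *
  have hc : c = 0 := by omega
  have he : e - b = 0 := by omega
  have he' : min b e = e := by omega
  subst hc
  simp [string2, insert2, row2, he, he']
  omega

theorem string2_zero_insert3 {T : Pattern} (hT : T.Valid) :
    string2 0 T.insert3 = (string2 0 T).insert2 ∧ (string2 0 T).row2 = 0 := by
  obtain ⟨a, b, c, d, e, f⟩ := T
  simp [string2, insert2, insert3, row2]
  omega

theorem string2_succ_insert3 {T : Pattern} (hT : T.Valid) {t : ℕ} (ht : t ≤ T.eps2 + T.phi2) :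
    string2 (t + 1) T.insert3 = (string2 t T).insert3 := by
  have h3 := hT.le3
  obtain ⟨b, c, d, e, q, q1, q2, q3⟩ := string2_spec h3 ht
  rw [q]
  clear q
  have ht' : t + 1 ≤ T.insert3.eps2 + T.insert3.phi2 := by
    rw [eps2_insert3, phi2_insert3]
    omega
  apply eq_string2 (T := T.insert3) h3 ht' <;> simp only [insert3] <;> omega

end Pattern

/-! ### Strings of words seen through insertion, and the braid relation for words. -/

namespace CrystalWord
open Pattern

theorem pattern_eps_phi (i : ℕ) (w : List ℕ) :
    (pattern i w).eps1 = wordEps i w ∧ (pattern i w).phi1 = phi i w ∧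
    (pattern i w).eps2 = wordEps (i + 1) w ∧ (pattern i w).phi2 = phi (i + 1) w := by
  induction w with
  | nil => simp [pattern, eps1, eps2, phi1, phi2, wordEps, phi]
  | cons x u ih =>
    obtain ⟨h1, h2, h3, h4⟩ := ih
    have hv := pattern_valid i u
    rw [phi_cons, phi_cons]
    have n1 : ¬ i = i + 1 + 1 := by omega
    have n2 : ¬ i + 1 + 1 = i := by omega
    by_cases c1 : x = i
    · subst c1
      simp [pattern, wordEps, n1, eps1_insert1, phi1_insert1 hv, eps2_insert1, phi2_insert1 hv,
        h1, h2, h3, h4]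
    · by_cases c2 : x = i + 1
      · subst c2
        simp [pattern, wordEps, eps1_insert2, phi1_insert2, eps2_insert2, phi2_insert2,
          h1, h2, h3, h4]
      · by_cases c3 : x = i + 1 + 1
        · subst c3
          simp [pattern, wordEps, n2, eps1_insert3, phi1_insert3, eps2_insert3, phi2_insert3,
            h1, h2, h3, h4]
        · simp [pattern, wordEps, c1, c2, c3, h1, h2, h3, h4]

/-- Crystal operators commute with insertion and do not affect the recording data. The induction
inserts the first letter last and uses the insertion lemma for the branch of `stringAt` at hand. -/
theorem pattern_stringAt (i : ℕ) (w : List ℕ) : ∀ t, t ≤ wordEps i w + phi i w →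
    pattern i (stringAt i t w) = string1 t (pattern i w) ∧
      record i (stringAt i t w) = record i w := by
  induction w with
  | nil =>
    intro t ht
    simp [phi, wordEps] at ht
    simp [stringAt, pattern, string1, ht]
  | cons x u ih =>
    intro t ht
    have hv := pattern_valid i u
    obtain ⟨h1, h2, -, -⟩ := pattern_eps_phi i u
    rw [phi_cons] at ht
    simp only [wordEps] at ht
    by_cases c2 : x = i + 1
    · subst c2
      simp only [if_true] at ht
      rcases t with _ | t
      · obtain ⟨k1, k2⟩ := ih 0 (by omega)
        obtain ⟨l1, l2⟩ := string1_zero_insert2 (pattern i u)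
        simp [stringAt, pattern, record, k1, k2, l1, l2]
      · obtain ⟨k1, k2⟩ := ih t (by omega)
        obtain ⟨l1, l2⟩ := string1_succ_insert2 (pattern i u) t
        simp [stringAt, pattern, record, k1, k2, l1, l2]
    · by_cases c1 : x = i
      · subst c1
        by_cases h0 : wordEps x u = 0
        · simp [h0] at ht
          rcases t with _ | t
          · obtain ⟨k1, k2⟩ := ih 0 (by omega)
            obtain ⟨l1, l2⟩ := string1_zero_insert1 (h1.trans h0)
            simp [stringAt, pattern, record, k1, k2, l1, l2, h0]
          · obtain ⟨k1, k2⟩ := ih t (by omega)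
            obtain ⟨l1, l2⟩ := string1_insert1_of_zero (t := t) (h1.trans h0)
            simp [stringAt, pattern, record, k1, k2, l1, l2, h0]
        · simp [h0] at ht
          obtain ⟨k1, k2⟩ := ih (t + 1) (by omega)
          obtain ⟨l1, l2⟩ := string1_insert1_of_pos (T := pattern x u) (t := t)
            (by rw [eps1_insert1, phi1_insert1 hv, h1, h2, if_neg h0]; exact ht) (by omega)
          simp [stringAt, pattern, record, k1, k2, l1, l2, h0]
      · simp [c1, c2] at ht
        obtain ⟨k1, k2⟩ := ih t ht
        by_cases c3 : x = i + 2
        · subst c3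
          simp [stringAt, pattern, record, k1, k2, string1_insert3]
        · simp [stringAt, pattern, record, k1, k2, c1, c2, c3]

theorem pattern_stringAt_succ (i : ℕ) (w : List ℕ) :
    ∀ t, t ≤ wordEps (i + 1) w + phi (i + 1) w →
    pattern i (stringAt (i + 1) t w) = string2 t (pattern i w) ∧
      record i (stringAt (i + 1) t w) = record i w := by
  induction w with
  | nil =>
    intro t ht
    simp [phi, wordEps] at ht
    simp [stringAt, pattern, string2, ht]
  | cons x u ih =>
    intro t ht
    have hv := pattern_valid i u
    have n1 : ¬ i = i + 1 + 1 := by omega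
    have n2 : ¬ i + 1 + 1 = i := by omega
    obtain ⟨-, -, h1, h2⟩ := pattern_eps_phi i u
    rw [phi_cons] at ht
    simp only [wordEps] at ht
    by_cases c2 : x = i + 1 + 1
    · subst c2
      simp only [if_true] at ht
      rcases t with _ | t
      · obtain ⟨k1, k2⟩ := ih 0 (by omega)
        obtain ⟨l1, l2⟩ := string2_zero_insert3 hv
        simp [stringAt, pattern, record, k1, k2, l1, l2, n2]
      · obtain ⟨k1, k2⟩ := ih t (by omega)
        have l1 := string2_succ_insert3 hv (t := t) (by omega)
        simp [stringAt, pattern, record, k1, k2, l1, n2]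
    · by_cases c1 : x = i + 1
      · subst c1
        by_cases h0 : wordEps (i + 1) u = 0
        · simp [h0] at ht
          rcases t with _ | t
          · obtain ⟨k1, k2⟩ := ih 0 (by omega)
            obtain ⟨l1, l2⟩ := string2_zero_insert2 hv (h1.trans h0)
            simp [stringAt, pattern, record, k1, k2, l1, l2, h0]
          · obtain ⟨k1, k2⟩ := ih t (by omega)
            obtain ⟨l1, l2⟩ := string2_insert2_of_zero hv (t := t) (by omega) (h1.trans h0)
            simp [stringAt, pattern, record, k1, k2, l1, l2, n2, h0]
        · simp [h0] at ht
          obtain ⟨k1, k2⟩ := ih (t + 1) (by omega)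
          obtain ⟨l1, l2⟩ := string2_insert2_of_pos hv (t := t) (by omega) (by omega)
          simp [stringAt, pattern, record, k1, k2, l1, l2, h0]
      · simp [c1, c2] at ht
        obtain ⟨k1, k2⟩ := ih t ht
        by_cases c3 : x = i
        · subst c3
          obtain ⟨l1, l2⟩ := string2_insert1 hv (t := t) (by omega)
          simp [stringAt, pattern, record, k1, k2, l1, l2, n1]
        · simp [stringAt, pattern, record, k1, k2, c1, c2, c3]

theorem pattern_reflect (i : ℕ) (w : List ℕ) :
    pattern i (reflect i w) = string1 (pattern i w).phi1 (pattern i w) := by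
  rw [reflect, (pattern_stringAt i w _ (by omega)).1, (pattern_eps_phi i w).2.1]

theorem record_reflect (i : ℕ) (w : List ℕ) : record i (reflect i w) = record i w := by
  rw [reflect, (pattern_stringAt i w _ (by omega)).2]

theorem pattern_reflect_succ (i : ℕ) (w : List ℕ) :
    pattern i (reflect (i + 1) w) = string2 (pattern i w).phi2 (pattern i w) := by
  rw [reflect, (pattern_stringAt_succ i w _ (by omega)).1, (pattern_eps_phi i w).2.2.2]

theorem record_reflect_succ (i : ℕ) (w : List ℕ) :
    record i (reflect (i + 1) w) = record i w := by
  rw [reflect, (pattern_stringAt_succ i w _ (by omega)).2]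

/-- The simple reflections on words satisfy the braid relation. -/
theorem reflect_braid (i : ℕ) (w : List ℕ) :
    reflect i (reflect (i + 1) (reflect i w)) =
      reflect (i + 1) (reflect i (reflect (i + 1) w)) := by
  apply eq_of_pattern_eq (i := i)
  · simp only [pattern_reflect, pattern_reflect_succ]
    exact braid (pattern_valid i w)
  · simp only [record_reflect, record_reflect_succ]

end CrystalWord

/-! ## Reading words -/

namespace CrystalWord

/-- The letters of the row `g` in the columns `a, …, a + k - 1`, read from right to left. -/
def seg (g : ℕ → ℕ) (a k : ℕ) : List ℕ := (List.range' a k).reverse.map g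

/-- The reading word of the rows `a, …, a + k - 1` of a filling with row lengths `len`. -/
def rows (F : ℕ → ℕ → ℕ) (len : ℕ → ℕ) (a k : ℕ) : List ℕ :=
  (List.range' a k).flatMap (fun r => seg (F r) 0 (len r))

theorem seg_succ (g : ℕ → ℕ) (a k : ℕ) : seg g a (k + 1) = g (a + k) :: seg g a k := by
  simp [seg, List.range'_concat]

theorem seg_add (g : ℕ → ℕ) (a k l : ℕ) : seg g a (k + l) = seg g (a + k) l ++ seg g a k := by
  simp only [seg]
  rw [← List.map_append, ← List.reverse_append, List.range'_append_1]

theorem seg_eq_append_cons (g : ℕ → ℕ) {c m : ℕ} (h : c < m) :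
    seg g 0 m = seg g (c + 1) (m - c - 1) ++ g c :: seg g 0 c := by
  obtain ⟨l, rfl⟩ : ∃ l, m = (c + 1) + l := ⟨m - c - 1, by omega⟩
  have h1 : c + 1 + l - c - 1 = l := by omega
  rw [seg_add, seg_succ, h1, Nat.zero_add, Nat.zero_add]

theorem seg_congr {g g' : ℕ → ℕ} {a k : ℕ} (h : ∀ c, a ≤ c → c < a + k → g c = g' c) :
    seg g a k = seg g' a k := by
  apply List.map_congr_left
  intro c hc
  rw [List.mem_reverse, List.mem_range'_1] at hc
  exact h c hc.1 hc.2

theorem rows_succ (F : ℕ → ℕ → ℕ) (len : ℕ → ℕ) (a k : ℕ) :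
    rows F len a (k + 1) = seg (F a) 0 (len a) ++ rows F len (a + 1) k := by
  simp [rows, List.range'_succ]

theorem rows_add (F : ℕ → ℕ → ℕ) (len : ℕ → ℕ) (a k l : ℕ) :
    rows F len a (k + l) = rows F len a k ++ rows F len (a + k) l := by
  simp only [rows]
  rw [← List.flatMap_append, List.range'_append_1]

theorem rows_eq_append (F : ℕ → ℕ → ℕ) (len : ℕ → ℕ) {r R : ℕ} (h : r < R) :
    rows F len 0 R = rows F len 0 r ++ (seg (F r) 0 (len r) ++ rows F len (r + 1) (R - r - 1)) := by
  obtain ⟨l, rfl⟩ : ∃ l, R = r + (l + 1) := ⟨R - r - 1, by omega⟩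
  have h1 : r + (l + 1) - r - 1 = l := by omega
  rw [rows_add, rows_succ, h1, Nat.zero_add]

theorem rows_congr {F F' : ℕ → ℕ → ℕ} {len : ℕ → ℕ} {a k : ℕ}
    (h : ∀ r c, a ≤ r → r < a + k → c < len r → F r c = F' r c) :
    rows F len a k = rows F' len a k := by
  simp only [rows]
  apply List.flatMap_congr
  intro r hr
  rw [List.mem_range'_1] at hr
  exact seg_congr fun c _ hc => h r c hr.1 hr.2 (by omega)

theorem exists_of_seg_eq {g : ℕ → ℕ} {x : ℕ} {D : List ℕ} : ∀ {k : ℕ} {C : List ℕ},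
    seg g 0 k = C ++ x :: D →
    ∃ c, c < k ∧ x = g c ∧ C = seg g (c + 1) (k - c - 1) ∧ D = seg g 0 c := by
  intro k
  induction k with
  | zero =>
    intro C h
    simp [seg] at h
  | succ k ih =>
    intro C h
    rw [seg_succ] at h
    rcases C with _ | ⟨y, C⟩
    · simp only [List.nil_append, List.cons.injEq, Nat.zero_add] at h
      exact ⟨k, by omega, h.1.symm, by simp [seg], h.2.symm⟩
    · simp only [List.cons_append, List.cons.injEq, Nat.zero_add] at h
      obtain ⟨c, h1, h2, h3, h4⟩ := ih h.2
      refine ⟨c, by omega, h2, ?_, h4⟩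
      have e1 : k + 1 - c - 1 = k - c - 1 + 1 := by omega
      have e2 : c + 1 + (k - c - 1) = k := by omega
      rw [e1, seg_succ, e2, h3, h.1]

/-- Splitting the reading word at a letter means choosing a box. This translates the position
changed by a word operator into a box, with explicit prefix and suffix. -/
theorem exists_of_rows_eq {F : ℕ → ℕ → ℕ} {len : ℕ → ℕ} {x : ℕ} {B : List ℕ} :
    ∀ {k a : ℕ} {A : List ℕ}, rows F len a k = A ++ x :: B →
    ∃ r c, a ≤ r ∧ r < a + k ∧ c < len r ∧ x = F r c ∧
      A = rows F len a (r - a) ++ seg (F r) (c + 1) (len r - c - 1) ∧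
      B = seg (F r) 0 c ++ rows F len (r + 1) (a + k - r - 1) := by
  intro k
  induction k with
  | zero =>
    intro a A h
    simp [rows] at h
  | succ k ih =>
    intro a A h
    rw [rows_succ] at h
    rcases List.append_eq_append_iff.1 h with ⟨A', h1, h2⟩ | ⟨C, h1, h2⟩
    · obtain ⟨r, c, k1, k2, k3, k4, k5, k6⟩ := ih h2
      refine ⟨r, c, by omega, by omega, k3, k4, ?_, ?_⟩
      · have e1 : r - a = r - (a + 1) + 1 := by omega
        rw [e1, rows_succ, h1, k5, List.append_assoc]
      · rw [k6]
        congr 3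
        omega
    · rcases C with _ | ⟨y, D⟩
      · simp only [List.nil_append] at h2
        simp only [List.append_nil] at h1
        obtain ⟨r, c, k1, k2, k3, k4, k5, k6⟩ := ih (A := []) h2.symm
        refine ⟨r, c, by omega, by omega, k3, k4, ?_, ?_⟩
        · have e1 : r - a = r - (a + 1) + 1 := by omega
          rw [e1, rows_succ, ← h1, List.append_assoc, ← k5, List.append_nil]
        · rw [k6]
          congr 3
          omega
      · simp only [List.cons_append, List.cons.injEq] at h2
        rw [← h2.1] at h1
        obtain ⟨c, k1, k2, k3, k4⟩ := exists_of_seg_eq h1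
        refine ⟨a, c, le_rfl, by omega, k1, k2, ?_, ?_⟩
        · simp [rows, k3]
        · rw [h2.2, k4]
          congr 3
          omega

/-! ## Estimates for `wordEps` -/

theorem wordEps_le_cons (i x : ℕ) (u : List ℕ) (h : x ≠ i) : wordEps i u ≤ wordEps i (x :: u) := by
  simp only [wordEps]
  split_ifs <;> omega

theorem wordEps_seg_ge (i : ℕ) (g : ℕ → ℕ) (Z : List ℕ) (a k : ℕ)
    (h : ∀ c, a ≤ c → c < a + k → g c ≠ i) : wordEps i Z ≤ wordEps i (seg g a k ++ Z) := by
  induction k with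
  | zero => simp [seg]
  | succ k ih =>
    rw [seg_succ, List.cons_append]
    exact le_trans (ih fun c h1 h2 => h c h1 (by omega))
      (wordEps_le_cons i _ _ (h _ (by omega) (by omega)))

theorem wordEps_seg_le (i : ℕ) (g : ℕ → ℕ) (Z : List ℕ) (a k : ℕ)
    (h : ∀ c, a ≤ c → c < a + k → g c ≠ i + 1) :
    wordEps i (seg g a k ++ Z) ≤ wordEps i Z := by
  induction k with
  | zero => simp [seg]
  | succ k ih =>
    rw [seg_succ, List.cons_append]
    have h1 := ih fun c h1 h2 => h c h1 (by omega)
    have h2 := h (a + k) (by omega) (by omega)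
    simp only [wordEps]
    split_ifs <;> omega

theorem wordEps_seg_self (i : ℕ) (g : ℕ → ℕ) (Z : List ℕ) (a k : ℕ)
    (h : ∀ c, a ≤ c → c < a + k → g c = i) :
    wordEps i (seg g a k ++ Z) = wordEps i Z - k := by
  induction k with
  | zero => simp [seg]
  | succ k ih =>
    rw [seg_succ, List.cons_append]
    have h1 := ih fun c h1 h2 => h c h1 (by omega)
    have h2 := h (a + k) (by omega) (by omega)
    simp only [wordEps]
    split_ifs <;> omega

theorem wordEps_seg_succ (i : ℕ) (g : ℕ → ℕ) (Z : List ℕ) (a k : ℕ)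
    (h : ∀ c, a ≤ c → c < a + k → g c = i + 1) :
    wordEps i (seg g a k ++ Z) = wordEps i Z + k := by
  induction k with
  | zero => simp [seg]
  | succ k ih =>
    rw [seg_succ, List.cons_append]
    have h1 := ih fun c h1 h2 => h c h1 (by omega)
    have h2 := h (a + k) (by omega) (by omega)
    simp only [wordEps]
    split_ifs
    omega

/-- f̃ᵢ changes the first `i` whose suffix has εᵢ = 0. An `i` directly before it would also have
such a suffix and would have been changed instead. -/
theorem exists_of_wordF {i : ℕ} {w w' : List ℕ} (h : wordF i w = some w') :
    ∃ A B, w = A ++ i :: B ∧ w' = A ++ (i + 1) :: B ∧ wordEps i B = 0 ∧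
      ∀ A', A ≠ A' ++ [i] := by
  induction w generalizing w' with
  | nil => simp [wordF] at h
  | cons x u ih =>
    simp only [wordF] at h
    split_ifs at h with h1
    · refine ⟨[], u, by simp [h1.1], by simpa using h.symm, h1.2, by simp⟩
    · rw [Option.map_eq_some_iff] at h
      obtain ⟨v, hv, rfl⟩ := h
      obtain ⟨A, B, rfl, rfl, h4, h5⟩ := ih hv
      refine ⟨x :: A, B, rfl, rfl, h4, ?_⟩
      intro A' hA
      rcases A' with _ | ⟨y, A'⟩
      · simp only [List.nil_append, List.cons.injEq] at hA
        rw [hA.2] at h1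
        apply h1
        refine ⟨hA.1, ?_⟩
        simp [wordEps, h4]
      · simp only [List.cons_append, List.cons.injEq] at hA
        exact h5 A' hA.2

/-- An earlier `i` is passed over only if εᵢ of its suffix exceeds φᵢ(i) = 1. This is what later
excludes an `i` directly above the changed box. -/
theorem exists_of_wordE {i : ℕ} {w w' : List ℕ} (h : wordE i w = some w') :
    ∃ A B, w = A ++ (i + 1) :: B ∧ w' = A ++ i :: B ∧ wordEps i B = 0 ∧
      ∀ A₁ A₂, A = A₁ ++ i :: A₂ → 1 < wordEps i (A₂ ++ (i + 1) :: B) := by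
  induction w generalizing w' with
  | nil => simp [wordE] at h
  | cons x u ih =>
    simp only [wordE] at h
    by_cases h1 : wordEps i u ≤ if x = i then 1 else 0
    · rw [if_pos h1] at h
      split_ifs at h with h2
      · refine ⟨[], u, by simp [h2], by simpa using h.symm, ?_, by simp⟩
        rw [if_neg (by omega)] at h1
        omega
    · rw [if_neg h1, Option.map_eq_some_iff] at h
      obtain ⟨v, hv, rfl⟩ := h
      obtain ⟨A, B, rfl, rfl, h4, h5⟩ := ih hv
      refine ⟨x :: A, B, rfl, rfl, h4, ?_⟩
      intro A₁ A₂ hA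
      rcases A₁ with _ | ⟨y, A₁⟩
      · simp only [List.nil_append, List.cons.injEq] at hA
        rw [if_pos hA.1, hA.2] at h1
        omega
      · simp only [List.cons_append, List.cons.injEq] at hA
        exact h5 A₁ A₂ hA.2

end CrystalWord

/-! ### Tableaux and their reading words. -/

namespace SST
open CrystalWord

theorem word_eq_rows {n : ℕ} {μ : YoungDiagram} (T : SST n μ) :
    T.word = rows T.entry μ.rowLen 0 (μ.colLen 0) := by
  simp only [word, rows, seg, List.range_eq_range']

theorem mem_iff {μ : YoungDiagram} {r c : ℕ} : (r, c) ∈ μ ↔ r < μ.colLen 0 ∧ c < μ.rowLen r := by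
  constructor
  · intro h
    exact ⟨YoungDiagram.mem_iff_lt_colLen.1 (μ.up_left_mem le_rfl (Nat.zero_le c) h),
      YoungDiagram.mem_iff_lt_rowLen.1 h⟩
  · intro h
    exact YoungDiagram.mem_iff_lt_rowLen.2 h.2

theorem word_injective {n : ℕ} {μ : YoungDiagram} :
    Function.Injective (word (n := n) (μ := μ)) := by
  intro T T' h
  have key : ∀ k a, rows T.entry μ.rowLen a k = rows T'.entry μ.rowLen a k →
      ∀ r c, a ≤ r → r < a + k → c < μ.rowLen r → T.entry r c = T'.entry r c := by
    intro k
    induction k with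
    | zero => intros; omega
    | succ k ih =>
      intro a h r c h1 h2 h3
      rw [rows_succ, rows_succ] at h
      obtain ⟨h4, h5⟩ := List.append_inj h (by simp [seg])
      rcases Nat.eq_or_lt_of_le h1 with rfl | h6
      · have h7 := List.map_inj_left.1 h4 c (by simp [List.mem_range'_1, h3])
        exact h7
      · exact ih _ h5 r c h6 (by omega) h3
  apply ext_entry
  intro r c hm
  rw [mem_iff] at hm
  rw [word_eq_rows, word_eq_rows] at h
  exact key _ _ h r c (Nat.zero_le r) (by omega) hm.2

end SST

/-! ## Crystal operators on tableaux -/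

namespace SST
open CrystalWord

theorem entry_mono {n : ℕ} {μ : YoungDiagram} (T : SST n μ) {r c c' : ℕ} (h : c ≤ c')
    (hm : (r, c') ∈ μ) : T.entry r c ≤ T.entry r c' := T.1.row_weak_of_le h hm

theorem entry_strict {n : ℕ} {μ : YoungDiagram} (T : SST n μ) {r r' c : ℕ} (h : r < r')
    (hm : (r', c) ∈ μ) : T.entry r c < T.entry r' c := T.1.col_strict h hm

theorem count_word {n : ℕ} {μ : YoungDiagram} (T : SST n μ) (v : ℕ) :
    T.word.count v = T.mult v := by
  let L : List (ℕ × ℕ) := (List.range (μ.colLen 0)).flatMap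
    (fun r => ((List.range (μ.rowLen r)).reverse.map (fun c => (r, c))))
  have hL : T.word = L.map (fun c => T.entry c.1 c.2) := by
    simp only [word, L, List.map_flatMap, List.map_map]
    rfl
  have hmem : ∀ p, p ∈ L ↔ p ∈ μ.cells := by
    rintro ⟨r, c⟩
    rw [YoungDiagram.mem_cells, mem_iff]
    simp only [L, List.mem_flatMap, List.mem_range, List.mem_map, List.mem_reverse, Prod.mk.injEq]
    constructor
    · rintro ⟨a, h1, b, h2, rfl, rfl⟩
      exact ⟨h1, h2⟩
    · rintro ⟨h1, h2⟩
      exact ⟨r, h1, c, h2, rfl, rfl⟩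
  have hnd : L.Nodup := by
    simp only [L]
    rw [List.nodup_flatMap]
    constructor
    · intro r _
      exact (List.nodup_reverse.2 List.nodup_range).map (fun a b h => (Prod.mk.inj h).2)
    · refine List.nodup_range.pairwise_of_forall_ne ?_
      intro a _ b _ hab
      simp only [Function.onFun, List.disjoint_left, List.mem_map, not_exists, not_and]
      rintro _ ⟨c, _, rfl⟩ d _ h
      exact hab (Prod.mk.inj h).1.symm
  have hfin : μ.cells = L.toFinset := by
    ext p
    rw [List.mem_toFinset, hmem]
  have hfil : L.toFinset.filter (fun c => T.entry c.1 c.2 = v) =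
      (L.filter (fun c => T.entry c.1 c.2 = v)).toFinset := by
    rw [List.toFinset_filter]
    simp only [decide_eq_true_eq]
  rw [hL, mult, hfin, List.count, List.countP_map, hfil,
    List.toFinset_card_of_nodup (hnd.filter _), List.countP_eq_length_filter]
  rfl

/-- Changing one entry of a tableau. -/
theorem exists_put {n : ℕ} {μ : YoungDiagram} (T : SST n μ) {r c v : ℕ} (hm : (r, c) ∈ μ)
    (h1 : 1 ≤ v) (hn : v ≤ n) (hl : ∀ d, c = d + 1 → T.entry r d ≤ v)
    (hr : (r, c + 1) ∈ μ → v ≤ T.entry r (c + 1)) (hu : ∀ s, r = s + 1 → T.entry s c < v)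
    (hd : (r + 1, c) ∈ μ → v < T.entry (r + 1) c) :
    ∃ T' : SST n μ, T'.entry = Promotion.put T.entry r c v := by
  refine ⟨⟨⟨Promotion.put T.entry r c v, ?_, ?_, ?_⟩, ?_⟩, rfl⟩
  · intro i j1 j2 hj hij
    by_cases e1 : i = r ∧ j1 = c
    · obtain ⟨rfl, rfl⟩ := e1
      rw [Promotion.put_same, Promotion.put_ne _ _ (by omega)]
      exact le_trans (hr (μ.up_left_mem le_rfl hj hij)) (T.entry_mono hj hij)
    · by_cases e2 : i = r ∧ j2 = c
      · obtain ⟨rfl, rfl⟩ := e2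
        rw [Promotion.put_same, Promotion.put_ne _ _ (by omega)]
        obtain ⟨d, rfl⟩ : ∃ d, j2 = d + 1 := ⟨j2 - 1, by omega⟩
        exact le_trans (T.entry_mono (by omega) (μ.up_left_mem le_rfl (Nat.le_succ d) hij))
          (hl d rfl)
      · rw [Promotion.put_ne _ _ e1, Promotion.put_ne _ _ e2]
        exact T.entry_mono hj.le hij
  · intro i1 i2 j hi hij
    by_cases e1 : i1 = r ∧ j = c
    · obtain ⟨rfl, rfl⟩ := e1
      rw [Promotion.put_same, Promotion.put_ne _ _ (by omega)]
      rcases Nat.eq_or_lt_of_le (show i1 + 1 ≤ i2 from hi) with rfl | h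
      · exact hd hij
      · exact lt_trans (hd (μ.up_left_mem hi le_rfl hij)) (T.entry_strict h hij)
    · by_cases e2 : i2 = r ∧ j = c
      · obtain ⟨rfl, rfl⟩ := e2
        rw [Promotion.put_same, Promotion.put_ne _ _ (by omega)]
        obtain ⟨d, rfl⟩ : ∃ d, i2 = d + 1 := ⟨i2 - 1, by omega⟩
        rcases Nat.eq_or_lt_of_le (Nat.le_of_lt_succ hi) with rfl | h
        · exact hu i1 rfl
        · exact lt_trans (T.entry_strict h (μ.up_left_mem (Nat.le_succ d) le_rfl hij)) (hu d rfl)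
      · rw [Promotion.put_ne _ _ e1, Promotion.put_ne _ _ e2]
        exact T.entry_strict hi hij
  · intro i j hij
    rw [Promotion.put_ne _ _ (by rintro ⟨rfl, rfl⟩; exact hij hm)]
    exact T.1.zeros hij
  · intro i j hij
    change 1 ≤ Promotion.put T.entry r c v i j ∧ Promotion.put T.entry r c v i j ≤ n
    by_cases e1 : i = r ∧ j = c
    · obtain ⟨rfl, rfl⟩ := e1
      rw [Promotion.put_same]
      exact ⟨h1, hn⟩
    · rw [Promotion.put_ne _ _ e1]
      exact T.2 i j hij

theorem word_put {n : ℕ} {μ : YoungDiagram} {T T' : SST n μ} {r c v : ℕ} (hm : (r, c) ∈ μ)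
    (h : T'.entry = Promotion.put T.entry r c v) :
    T'.word = (rows T.entry μ.rowLen 0 r ++ seg (T.entry r) (c + 1) (μ.rowLen r - c - 1)) ++
      v :: (seg (T.entry r) 0 c ++ rows T.entry μ.rowLen (r + 1) (μ.colLen 0 - r - 1)) := by
  rw [mem_iff] at hm
  rw [word_eq_rows, rows_eq_append _ _ hm.1, seg_eq_append_cons _ hm.2, h, Promotion.put_same]
  have e1 : rows (Promotion.put T.entry r c v) μ.rowLen 0 r = rows T.entry μ.rowLen 0 r :=
    rows_congr fun a b _ h2 _ => Promotion.put_ne _ _ (by omega)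
  have e2 : seg (Promotion.put T.entry r c v r) (c + 1) (μ.rowLen r - c - 1) =
      seg (T.entry r) (c + 1) (μ.rowLen r - c - 1) :=
    seg_congr fun b h1 _ => Promotion.put_ne _ _ (by omega)
  have e3 : seg (Promotion.put T.entry r c v r) 0 c = seg (T.entry r) 0 c :=
    seg_congr fun b _ h1 => Promotion.put_ne _ _ (by omega)
  have e4 : rows (Promotion.put T.entry r c v) μ.rowLen (r + 1) (μ.colLen 0 - r - 1) =
      rows T.entry μ.rowLen (r + 1) (μ.colLen 0 - r - 1) :=
    rows_congr fun a b h1 _ _ => Promotion.put_ne _ _ (by omega)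
  rw [e1, e2, e3, e4]
  simp only [List.append_assoc, List.cons_append]

/-- Raising a box from `i` to `i + 1` can only violate the order with its right and lower
neighbours. Both violations contradict the position that f̃ᵢ selects. -/
theorem exists_word_of_wordF {n : ℕ} {μ : YoungDiagram} {i : ℕ} (hi : i < n)
    {T : SST n μ} {w : List ℕ} (h : wordF i T.word = some w) : ∃ T' : SST n μ, w = T'.word := by
  obtain ⟨A, B, hw, rfl, hB, hA⟩ := exists_of_wordF h
  rw [word_eq_rows] at hw
  obtain ⟨r, c, -, h1, h2, h3, rfl, rfl⟩ := exists_of_rows_eq hw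
  simp only [Nat.zero_add, Nat.sub_zero] at *
  have hm : (r, c) ∈ μ := mem_iff.2 ⟨h1, h2⟩
  obtain ⟨T', hT'⟩ : ∃ T' : SST n μ, T'.entry = Promotion.put T.entry r c (i + 1) := by
    refine exists_put T hm (by omega) hi ?_ ?_ ?_ ?_
    · rintro d rfl
      have := T.entry_mono (show d ≤ d + 1 by omega) hm
      omega
    · intro hm'
      have e1 := T.entry_mono (show c ≤ c + 1 by omega) hm'
      have e2 := (mem_iff.1 hm').2
      by_contra e3
      -- The right neighbour is read immediately before the changed letter, so the prefix would end
      -- in `i`.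
      have e4 : T.entry r (c + 1) = i := by omega
      refine hA (rows T.entry μ.rowLen 0 r ++
        seg (T.entry r) (c + 2) (μ.rowLen r - c - 2)) ?_
      have e5 : μ.rowLen r - c - 1 = 1 + (μ.rowLen r - c - 2) := by omega
      rw [e5, seg_add, List.append_assoc]
      congr 2
      simp [seg, e4]
    · rintro s rfl
      have := T.entry_strict (show s < s + 1 by omega) hm
      omega
    · intro hm'
      have e1 := T.entry_strict (show r < r + 1 by omega) hm'
      by_contra e2
      have e3 : T.entry (r + 1) c = i + 1 := by omega
      obtain ⟨e4, e5⟩ := mem_iff.1 hm'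
      classical
      -- Let a be the first column of row r with entry `i`. Below columns a, …, c there are c + 1 -
      -- a letters `i + 1`, all in the suffix, while only c - a of the letters `i` above them are.
      -- So εᵢ of the suffix is positive, contrary to `hB`.
      have hex : ∃ d, T.entry r d = i := ⟨c, h3.symm⟩
      let a := Nat.find hex
      have ha : T.entry r a = i := Nat.find_spec hex
      have hac : a ≤ c := Nat.find_min' hex h3.symm
      have hlt : ∀ d, d < a → T.entry r d ≠ i := fun d hd => Nat.find_min hex hd
      have heq : ∀ d, a ≤ d → d ≤ c → T.entry r d = i := by
        intro d k1 k2
        have k3 := T.entry_mono k1 (μ.up_left_mem le_rfl k2 hm)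
        have k4 := T.entry_mono k2 hm
        omega
      have heq' : ∀ d, a ≤ d → d < a + (c + 1 - a) → T.entry (r + 1) d = i + 1 := by
        intro d k1 k2
        have k3 := T.entry_strict (show r < r + 1 by omega) (μ.up_left_mem le_rfl
          (show d ≤ c by omega) hm')
        have k4 := T.entry_mono (show d ≤ c by omega) hm'
        have k5 := heq d k1 (by omega)
        omega
      have hne : ∀ d, c + 1 ≤ d → d < c + 1 + (μ.rowLen (r + 1) - c - 1) →
          T.entry (r + 1) d ≠ i := by
        intro d k1 k2
        have := T.entry_mono (show c ≤ d by omega)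
          (mem_iff.2 ⟨e4, show d < μ.rowLen (r + 1) by omega⟩)
        omega
      have f1 : μ.colLen 0 - r - 1 = μ.colLen 0 - r - 2 + 1 := by omega
      have f2 : μ.rowLen (r + 1) = a + (c + 1 - a) + (μ.rowLen (r + 1) - c - 1) := by omega
      have f3 : a + (c + 1 - a) = c + 1 := by omega
      have f4 : c = a + (c - a) := by omega
      rw [f1, rows_succ, f2, seg_add, seg_add, f3, Nat.zero_add, Nat.zero_add] at hB
      rw [show seg (T.entry r) 0 c = seg (T.entry r) (0 + a) (c - a) ++ seg (T.entry r) 0 a by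
        rw [← seg_add, ← f4], Nat.zero_add] at hB
      simp only [List.append_assoc] at hB
      rw [wordEps_seg_self _ _ _ _ _ (fun d k1 k2 => heq d k1 (by omega))] at hB
      have g1 := wordEps_seg_ge i (T.entry r) (seg (T.entry (r + 1)) (c + 1)
        (μ.rowLen (r + 1) - c - 1) ++ (seg (T.entry (r + 1)) a (c + 1 - a) ++
          (seg (T.entry (r + 1)) 0 a ++
            rows T.entry μ.rowLen (r + 1 + 1) (μ.colLen 0 - r - 2)))) 0 a
        (fun d _ k2 => hlt d (by omega))
      have g2 := wordEps_seg_ge i (T.entry (r + 1)) (seg (T.entry (r + 1)) a (c + 1 - a) ++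
          (seg (T.entry (r + 1)) 0 a ++
            rows T.entry μ.rowLen (r + 1 + 1) (μ.colLen 0 - r - 2)))
        (c + 1) (μ.rowLen (r + 1) - c - 1) hne
      rw [wordEps_seg_succ _ _ _ _ _ heq'] at g2
      omega
  exact ⟨T', (word_put hm hT').symm⟩

/-- Lowering a box from `i + 1` to `i` can only conflict with the left and upper neighbours. A left
neighbour `i + 1` would give the suffix positive εᵢ; an upper neighbour `i` is excluded by counting.
-/
theorem exists_word_of_wordE {n : ℕ} {μ : YoungDiagram} {i : ℕ} (hi : 1 ≤ i)
    {T : SST n μ} {w : List ℕ} (h : wordE i T.word = some w) : ∃ T' : SST n μ, w = T'.word := by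
  obtain ⟨A, B, hw, rfl, hB, hA⟩ := exists_of_wordE h
  rw [word_eq_rows] at hw
  obtain ⟨r, c, -, h1, h2, h3, rfl, rfl⟩ := exists_of_rows_eq hw
  simp only [Nat.zero_add, Nat.sub_zero] at *
  have hm : (r, c) ∈ μ := mem_iff.2 ⟨h1, h2⟩
  obtain ⟨T', hT'⟩ : ∃ T' : SST n μ, T'.entry = Promotion.put T.entry r c i := by
    refine exists_put T hm hi (by have := (T.2 r c hm).2; change T.entry r c ≤ n at this; omega)
      ?_ ?_ ?_ ?_
    · rintro d rfl
      have e1 := T.entry_mono (show d ≤ d + 1 by omega) hm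
      by_contra e2
      have e3 : T.entry r d = i + 1 := by omega
      rw [seg_succ, Nat.zero_add, e3] at hB
      simp [wordEps] at hB
    · intro hm'
      have := T.entry_mono (show c ≤ c + 1 by omega) hm'
      omega
    · rintro s rfl
      have e1 := T.entry_strict (show s < s + 1 by omega) hm
      by_contra e2
      have e3 : T.entry s c = i := by omega
      -- Let d be the last column of row s + 1 with entry `i + 1`. In columns c, …, d there is an
      -- `i` above every `i + 1`. After the `i` at (s, d), the d - c + 1 letters `i + 1` meet d - c
      -- letters `i`, leaving εᵢ at most 1. But passing over that `i` required εᵢ > 1.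
      obtain ⟨d, hd1, hd2, hd3, hd4⟩ : ∃ d, c ≤ d ∧ d < μ.rowLen (s + 1) ∧
          T.entry (s + 1) d = i + 1 ∧
          ∀ e, d < e → e < μ.rowLen (s + 1) → T.entry (s + 1) e ≠ i + 1 := by
        classical
        let P := fun e => T.entry (s + 1) e = i + 1 ∧ e < μ.rowLen (s + 1)
        have k0 : P c := ⟨h3.symm, h2⟩
        have k1 : P (Nat.findGreatest P (μ.rowLen (s + 1))) :=
          Nat.findGreatest_spec h2.le k0
        refine ⟨_, Nat.le_findGreatest h2.le k0, k1.2, k1.1, ?_⟩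
        intro e k2 k3 k4
        have := Nat.le_findGreatest k3.le (show P e from ⟨k4, k3⟩)
        omega
      have hmd : (s + 1, d) ∈ μ := mem_iff.2 ⟨h1, hd2⟩
      have hmd' : (s, d) ∈ μ := μ.up_left_mem (Nat.le_succ s) le_rfl hmd
      have heq : ∀ e, c ≤ e → e < c + (d - c) → T.entry s e = i := by
        intro e k1 k2
        have k3 := T.entry_strict (show s < s + 1 by omega) (μ.up_left_mem le_rfl
          (show e ≤ d by omega) hmd)
        have k4 := T.entry_mono (show e ≤ d by omega) hmd
        have k5 := T.entry_mono k1 (μ.up_left_mem le_rfl (show e ≤ d by omega) hmd')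
        omega
      have hsd : T.entry s d = i := by
        have k3 := T.entry_strict (show s < s + 1 by omega) hmd
        have k5 := T.entry_mono hd1 hmd'
        omega
      have heq' : ∀ e, c + 1 ≤ e → e < c + 1 + (d - c) → T.entry (s + 1) e = i + 1 := by
        intro e k1 k2
        have k4 := T.entry_mono (show e ≤ d by omega) hmd
        have k5 := T.entry_mono (show c ≤ e by omega) (μ.up_left_mem le_rfl
          (show e ≤ d by omega) hmd)
        omega
      have hlow : ∀ e, 0 ≤ e → e < 0 + c → T.entry s e ≠ i + 1 := by
        intro e _ k2
        have := T.entry_mono (show e ≤ c by omega) (μ.up_left_mem (Nat.le_succ s) le_rfl hm)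
        omega
      have g0 := hA (rows T.entry μ.rowLen 0 s ++
          seg (T.entry s) (d + 1) (μ.rowLen s - d - 1))
        (seg (T.entry s) 0 d ++ seg (T.entry (s + 1)) (c + 1) (μ.rowLen (s + 1) - c - 1)) (by
          have k1 : rows T.entry μ.rowLen 0 (s + 1) = rows T.entry μ.rowLen 0 s ++
              seg (T.entry s) 0 (μ.rowLen s) := by
            rw [rows_add, rows_succ]
            simp [rows]
          rw [k1, seg_eq_append_cons _ (mem_iff.1 hmd').2, hsd]
          simp only [List.append_assoc, List.cons_append])
      have f1 : μ.rowLen (s + 1) - c - 1 = (d - c) + (μ.rowLen (s + 1) - d - 1) := by omega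
      have f2 : c + 1 + (d - c) = d + 1 := by omega
      have f4 : d = c + (d - c) := by omega
      rw [show seg (T.entry s) 0 d = seg (T.entry s) (0 + c) (d - c) ++ seg (T.entry s) 0 c by
        rw [← seg_add, ← f4], Nat.zero_add, f1, seg_add, f2] at g0
      simp only [List.append_assoc] at g0
      rw [wordEps_seg_self _ _ _ _ _ heq] at g0
      have g1 := wordEps_seg_le i (T.entry s) (seg (T.entry (s + 1)) (d + 1)
        (μ.rowLen (s + 1) - d - 1) ++ (seg (T.entry (s + 1)) (c + 1) (d - c) ++
          (i + 1) :: (seg (T.entry (s + 1)) 0 c ++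
            rows T.entry μ.rowLen (s + 1 + 1) (μ.colLen 0 - (s + 1) - 1)))) 0 c hlow
      have g2 := wordEps_seg_le i (T.entry (s + 1)) (seg (T.entry (s + 1)) (c + 1) (d - c) ++
          (i + 1) :: (seg (T.entry (s + 1)) 0 c ++
            rows T.entry μ.rowLen (s + 1 + 1) (μ.colLen 0 - (s + 1) - 1))) (d + 1)
        (μ.rowLen (s + 1) - d - 1) (fun e k1 k2 => hd4 e (by omega) (by omega))
      rw [wordEps_seg_succ _ _ _ _ _ heq'] at g2
      simp only [wordEps, if_true, hB] at g2
      omega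
    · intro hm'
      have := T.entry_strict (show r < r + 1 by omega) hm'
      omega
  exact ⟨T', (word_put hm hT').symm⟩

/-- Since the word operator stays among reading words of the shape, the tableau operator is zero
only when the word operator is. -/
theorem map_word_crystalF {n : ℕ} {μ : YoungDiagram} {i : ℕ} (hi : i < n) (T : SST n μ) :
    (crystalF i T).map word = wordF i T.word := by
  unfold crystalF
  split_ifs with h
  · rw [Option.map_some, ← h.choose_spec]
  · rcases hw : wordF i T.word with _ | w
    · rfl
    · obtain ⟨T', rfl⟩ := exists_word_of_wordF hi hw
      exact absurd ⟨T', hw⟩ h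

theorem map_word_crystalE {n : ℕ} {μ : YoungDiagram} {i : ℕ} (hi : 1 ≤ i) (T : SST n μ) :
    (crystalE i T).map word = wordE i T.word := by
  unfold crystalE
  split_ifs with h
  · rw [Option.map_some, ← h.choose_spec]
  · rcases hw : wordE i T.word with _ | w
    · rfl
    · obtain ⟨T', rfl⟩ := exists_word_of_wordE hi hw
      exact absurd ⟨T', hw⟩ h

theorem map_iterate_bind {α β : Type*} (g : α → β) (f : α → Option α) (f' : β → Option β)
    (h : ∀ a, (f a).map g = f' (g a)) (k : ℕ) (o : Option α) :
    ((fun o => Option.bind o f)^[k] o).map g = (fun o => Option.bind o f')^[k] (o.map g) := by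
  induction k generalizing o with
  | zero => rfl
  | succ k ih =>
    rw [Function.iterate_succ_apply, Function.iterate_succ_apply, ih]
    congr 1
    cases o with
    | none => rfl
    | some a => exact h a

/-- Applying |cᵢ - cᵢ₊₁| operators leads exactly to the mirror position of the string, so the power
is nonzero and the default of `getD` is never reached. -/
theorem word_sTilde {n : ℕ} {μ : YoungDiagram} {i : ℕ} (hi : 1 ≤ i) (hn : i < n) (T : SST n μ) :
    (sTilde i T).word = reflect i T.word := by
  unfold sTilde
  split_ifs with h
  · have h1 := map_iterate_bind word (crystalF i) (wordF i) (map_word_crystalF hn)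
      (T.mult i - T.mult (i + 1)) (some T)
    rw [Option.map_some, ← count_word, ← count_word,
      iterate_wordF_eq_reflect i _ (by rwa [count_word, count_word])] at h1
    obtain ⟨T', h2, h3⟩ := Option.map_eq_some_iff.1 h1
    rw [← count_word, ← count_word, h2, Option.getD_some, h3]
  · have h1 := map_iterate_bind word (crystalE i) (wordE i) (map_word_crystalE hi)
      (T.mult (i + 1) - T.mult i) (some T)
    rw [Option.map_some, ← count_word, ← count_word,
      iterate_wordE_eq_reflect i _ (by rw [count_word, count_word]; omega)] at h1
    obtain ⟨T', h2, h3⟩ := Option.map_eq_some_iff.1 h1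
    rw [← count_word, ← count_word, h2, Option.getD_some, h3]

end SST

/-! ## Promotion is a bijection which rotates contents -/

namespace Promotion

/-- The number of boxes of `μ` in which the filling `F` has the entry `v`. -/
def cnt (μ : YoungDiagram) (F : ℕ → ℕ → ℕ) (v : ℕ) : ℕ :=
  (μ.cells.filter (fun c => F c.1 c.2 = v)).card

theorem cnt_put {μ : YoungDiagram} (F : ℕ → ℕ → ℕ) {i j : ℕ} (w v : ℕ) (hm : (i, j) ∈ μ) :
    cnt μ (put F i j w) v + (if F i j = v then 1 else 0) =
      cnt μ F v + (if w = v then 1 else 0) := by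
  have hm' : (i, j) ∈ μ.cells := (YoungDiagram.mem_cells _).2 hm
  have h1 : ∀ G : ℕ → ℕ → ℕ, cnt μ G v = (if G i j = v then 1 else 0) +
      ∑ c ∈ μ.cells.erase (i, j), (if G c.1 c.2 = v then 1 else 0) := by
    intro G
    rw [cnt, Finset.card_filter, ← Finset.add_sum_erase _ _ hm']
  have h2 : ∑ c ∈ μ.cells.erase (i, j), (if put F i j w c.1 c.2 = v then 1 else 0) =
      ∑ c ∈ μ.cells.erase (i, j), (if F c.1 c.2 = v then 1 else 0) := by
    apply Finset.sum_congr rfl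
    rintro ⟨r, c⟩ hc
    rw [put_ne]
    rintro ⟨rfl, rfl⟩
    simp at hc
  rw [h1, h1 F, h2, put_same]
  omega

/-- The stored value at the moving dot is stale; the `if` on the left accounts for it. Each move
copies a neighbour into the hole and makes that neighbour the stale value, so the counts telescope.
-/
theorem cnt_slide {μ : YoungDiagram} (v i j : ℕ) (F : ℕ → ℕ → ℕ) (hm : (i, j) ∈ μ) :
    cnt μ (slide i j F) v + (if F i j = v then 1 else 0) =
      cnt μ F v + (if 0 = v then 1 else 0) := by
  have trans : ∀ {a b c x y z : ℕ}, a + x = b + z → b + y = c + x → a + y = c + z := by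
    intros
    omega
  induction i, j, F using slide.induct with
  | case1 F => rw [slide, cnt_put _ _ _ hm]
  | case2 j F h0 => rw [slide, if_pos h0, cnt_put _ _ _ hm]
  | case3 j F h0 ih =>
    rw [slide, if_neg h0]
    have h1 := ih (μ.up_left_mem le_rfl (Nat.le_succ j) hm)
    rw [put_ne _ _ (by omega)] at h1
    exact trans h1 (cnt_put F (F 0 j) v hm)
  | case4 i F h0 => rw [slide, if_pos h0, cnt_put _ _ _ hm]
  | case5 i F h0 ih =>
    rw [slide, if_neg h0]
    have h1 := ih (μ.up_left_mem (Nat.le_succ i) le_rfl hm)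
    rw [put_ne _ _ (by omega)] at h1
    exact trans h1 (cnt_put F (F i 0) v hm)
  | case6 i j F h0 => rw [slide, if_pos h0, cnt_put _ _ _ hm]
  | case7 i j F h0 h1 ih =>
    rw [slide, if_neg h0, if_pos h1]
    have h1 := ih (μ.up_left_mem (Nat.le_succ i) le_rfl hm)
    rw [put_ne _ _ (by omega)] at h1
    exact trans h1 (cnt_put F (F i (j + 1)) v hm)
  | case8 i j F h0 h1 ih =>
    rw [slide, if_neg h0, if_neg h1]
    have h1 := ih (μ.up_left_mem le_rfl (Nat.le_succ j) hm)
    rw [put_ne _ _ (by omega)] at h1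
    exact trans h1 (cnt_put F (F (i + 1) j) v hm)

theorem slide_of_not_mem {μ : YoungDiagram} (i j : ℕ) (F : ℕ → ℕ → ℕ) (hm : (i, j) ∈ μ)
    {r c : ℕ} (h : (r, c) ∉ μ) : slide i j F r c = F r c := by
  have hne : ∀ i j, (i, j) ∈ μ → ¬ (r = i ∧ c = j) := by
    rintro i j hm ⟨rfl, rfl⟩
    exact h hm
  induction i, j, F using slide.induct with
  | case1 F => rw [slide, put_ne _ _ (hne _ _ hm)]
  | case2 j F h0 => rw [slide, if_pos h0, put_ne _ _ (hne _ _ hm)]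
  | case3 j F h0 ih =>
    rw [slide, if_neg h0, ih (μ.up_left_mem le_rfl (Nat.le_succ j) hm), put_ne _ _ (hne _ _ hm)]
  | case4 i F h0 => rw [slide, if_pos h0, put_ne _ _ (hne _ _ hm)]
  | case5 i F h0 ih =>
    rw [slide, if_neg h0, ih (μ.up_left_mem (Nat.le_succ i) le_rfl hm), put_ne _ _ (hne _ _ hm)]
  | case6 i j F h0 => rw [slide, if_pos h0, put_ne _ _ (hne _ _ hm)]
  | case7 i j F h0 h1 ih =>
    rw [slide, if_neg h0, if_pos h1, ih (μ.up_left_mem (Nat.le_succ i) le_rfl hm),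
      put_ne _ _ (hne _ _ hm)]
  | case8 i j F h0 h1 ih =>
    rw [slide, if_neg h0, if_neg h1, ih (μ.up_left_mem le_rfl (Nat.le_succ j) hm),
      put_ne _ _ (hne _ _ hm)]

/-- The box at the bottom of a column. -/
theorem bottom_mem {μ : YoungDiagram} {q : ℕ} (hq : q < μ.rowLen 0) :
    (μ.colLen q - 1, q) ∈ μ := by
  have h0 : 0 < μ.colLen q :=
    YoungDiagram.mem_iff_lt_colLen.1 (YoungDiagram.mem_iff_lt_rowLen.2 hq)
  exact YoungDiagram.mem_iff_lt_colLen.2 (by omega)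

theorem slideCols_same {n : ℕ} {μ : YoungDiagram} (T : SST n μ) {q : ℕ} (hq : q ≤ μ.rowLen 0)
    {r c : ℕ} (h : q ≤ c) : slideCols μ n T.entry q r c = T.entry r c := by
  obtain ⟨l, hl⟩ := slideCols_inv T q hq
  exact hl.same r c h

theorem slideCols_of_not_mem {n : ℕ} {μ : YoungDiagram} (T : SST n μ) {q : ℕ}
    (hq : q ≤ μ.rowLen 0) {r c : ℕ} (h : (r, c) ∉ μ) : slideCols μ n T.entry q r c = 0 := by
  induction q with
  | zero => exact T.1.zeros h
  | succ q ih =>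
    rw [slideCols]
    split_ifs with h1
    · rw [slide_of_not_mem _ _ _ (bottom_mem hq) h, ih (by omega)]
    · exact ih (by omega)

theorem cnt_slideCols {n : ℕ} {μ : YoungDiagram} (hn : 0 < n) (T : SST n μ) {q : ℕ}
    (hq : q ≤ μ.rowLen 0) :
    (∀ v, v ≠ 0 → v ≠ n → cnt μ (slideCols μ n T.entry q) v = cnt μ T.entry v) ∧
    cnt μ (slideCols μ n T.entry q) 0 + cnt μ (slideCols μ n T.entry q) n =
      cnt μ T.entry 0 + cnt μ T.entry n := by
  induction q with
  | zero => exact ⟨fun _ _ _ => rfl, rfl⟩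
  | succ q ih =>
    obtain ⟨ih1, ih2⟩ := ih (by omega)
    rw [slideCols]
    split_ifs with h1
    · have h2 : ∀ v, _ := fun v => cnt_slide v _ _ (slideCols μ n T.entry q) (bottom_mem hq)
      rw [slideCols_same T (by omega) le_rfl, h1] at h2
      refine ⟨?_, ?_⟩
      · intro v hv hv'
        have := h2 v
        rw [if_neg hv'.symm, if_neg hv.symm, ih1 v hv hv'] at this
        exact this
      · have k1 := h2 0
        have k2 := h2 n
        rw [if_neg hn.ne', if_pos rfl] at k1
        rw [if_pos rfl, if_neg hn.ne] at k2
        omega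
    · exact ⟨ih1, ih2⟩

/-! ### Inverse slides. -/

/-- The inverse slide: a dot in position `(i, j)` is exchanged with the smaller of the letters
`< n` below it and to its right, with the lower one if they are equal, at most `k` times, and is
then replaced by `n`. -/
def unslide (μ : YoungDiagram) (n : ℕ) : ℕ → ℕ → ℕ → (ℕ → ℕ → ℕ) → (ℕ → ℕ → ℕ)
  | 0, i, j, F => put F i j n
  | k + 1, i, j, F =>
      if (i + 1, j) ∈ μ ∧ F (i + 1) j < n ∧ ((i, j + 1) ∈ μ → F (i + 1) j ≤ F i (j + 1)) then
        unslide μ n k (i + 1) j (put F i j (F (i + 1) j))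
      else if (i, j + 1) ∈ μ ∧ F i (j + 1) < n then
        unslide μ n k i (j + 1) (put F i j (F i (j + 1)))
      else put F i j n

theorem put_put (F : ℕ → ℕ → ℕ) (i j v w : ℕ) : put (put F i j v) i j w = put F i j w := by
  funext r c
  simp only [put]
  split_ifs <;> rfl

theorem put_self (F : ℕ → ℕ → ℕ) (i j : ℕ) : put F i j (F i j) = F := by
  funext r c
  simp only [put]
  split_ifs with h
  · rw [h.1, h.2]
  · rfl

theorem unslide_put (μ : YoungDiagram) (n k i j v : ℕ) (F : ℕ → ℕ → ℕ) :
    unslide μ n k i j (put F i j v) = unslide μ n k i j F := by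
  cases k with
  | zero => rw [unslide, unslide, put_put]
  | succ k =>
    rw [unslide, unslide, put_ne (r := i + 1) F v (by omega), put_ne (c := j + 1) F v (by omega),
      put_put, put_put, put_put]

/-- After an upward move the letter below the dot is the old F(i, j), and the one to its right, if
any, is F(i, j+1) ≥ F(i, j). The tie rule of the inverse slide therefore sends the dot back down. -/
theorem unslide_up {μ : YoungDiagram} {n Q i j : ℕ} {l : ℕ → ℕ} {F : ℕ → ℕ → ℕ}
    (h : HoleInv μ n Q (i + 1) j l F) (k : ℕ) :
    unslide μ n (k + 1) i j (put F (i + 1) j (F i j)) = unslide μ n k (i + 1) j F := by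
  have hm : (i, j) ∈ μ := μ.up_left_mem (Nat.le_succ i) le_rfl h.mem
  have e : put (put F (i + 1) j (F i j)) i j (F i j) = put F (i + 1) j (F i j) := by
    have := put_self (put F (i + 1) j (F i j)) i j
    rwa [put_ne (r := i) F _ (by omega)] at this
  rw [unslide, put_same, if_pos, e, unslide_put]
  refine ⟨h.mem, h.lt i j hm h.colQ (by omega), ?_⟩
  intro hm'
  rw [put_ne _ _ (by omega)]
  exact h.row i j (j + 1) (by omega) hm' (by omega) (by omega)

/-- After a leftward move the letter to the right is F(i, j), strictly smaller than any letter below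
by column strictness. The inverse slide must go right. -/
theorem unslide_left {μ : YoungDiagram} {n Q i j : ℕ} {l : ℕ → ℕ} {F : ℕ → ℕ → ℕ}
    (h : HoleInv μ n Q i (j + 1) l F) (k : ℕ) :
    unslide μ n (k + 1) i j (put F i (j + 1) (F i j)) = unslide μ n k i (j + 1) F := by
  have hm : (i, j) ∈ μ := μ.up_left_mem le_rfl (Nat.le_succ j) h.mem
  have hQ := h.colQ
  have e : put (put F i (j + 1) (F i j)) i j (F i j) = put F i (j + 1) (F i j) := by
    have := put_self (put F i (j + 1) (F i j)) i j
    rwa [put_ne (c := j) F _ (by omega)] at this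
  rw [unslide, put_same, if_neg, if_pos, e, unslide_put]
  · exact ⟨h.mem, h.lt i j hm (by omega) (by omega)⟩
  · rintro ⟨h1, h2, h3⟩
    have h4 := h3 h.mem
    rw [put_ne _ _ (by omega)] at h4
    have := h.col i (i + 1) j (by omega) h1 (by omega) (by omega)
    omega

/-- A dot can stop only when blocked by zeros or the border. Zeros lie in the top row, to the left
of the previous path, so the dot comes to rest just after the dots already there. -/
theorem HoleInv.final {μ : YoungDiagram} {N Q i j : ℕ} {l : ℕ → ℕ} {F : ℕ → ℕ → ℕ}
    (h : HoleInv μ N Q i j l F) (hu : ∀ m, i = m + 1 → F m j = 0)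
    (hl : ∀ m, j = m + 1 → F i m = 0) : i = 0 ∧ j = l 0 := by
  have hi : i = 0 := by
    by_contra hi
    obtain ⟨m, rfl⟩ : ∃ m, i = m + 1 := ⟨i - 1, by omega⟩
    have h1 := hu m rfl
    have hm : (m, j) ∈ μ := μ.up_left_mem (Nat.le_succ m) le_rfl h.mem
    cases m with
    | zero =>
      have h2 := (h.zero j hm (by omega)).1 h1
      have h3 := h.mono 0 1 (by omega) le_rfl
      have h4 := h.le
      simp only [zero_add] at h4
      omega
    | succ k =>
      have := h.pos k j hm (by omega)
      omega
  subst hi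
  refine ⟨rfl, ?_⟩
  have h1 := h.le
  rcases j with _ | m
  · omega
  · have h2 := (h.zero m (μ.up_left_mem le_rfl (Nat.le_succ m) h.mem) (by omega)).1 (hl m rfl)
    omega

theorem unslide_slide {μ : YoungDiagram} {N Q : ℕ} (i j : ℕ) (F : ℕ → ℕ → ℕ)
    (l : ℕ → ℕ) (h : HoleInv μ N Q i j l F) :
    (∃ d, d ≤ i + j ∧
      ∀ k, unslide μ N (k + d) 0 (l 0) (slide i j F) = unslide μ N k i j F) ∧
    (0, l 0) ∈ μ ∧ ∀ c, (0, c) ∈ μ → (slide i j F 0 c = 0 ↔ c < l 0 + 1) := by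
  have halt : ∀ (i j : ℕ) (F : ℕ → ℕ → ℕ), HoleInv μ N Q i j l F →
      (∀ m, i = m + 1 → F m j = 0) → (∀ m, j = m + 1 → F i m = 0) →
      (∃ d, d ≤ i + j ∧
        ∀ k, unslide μ N (k + d) 0 (l 0) (put F i j 0) = unslide μ N k i j F) ∧
      (0, l 0) ∈ μ ∧ ∀ c, (0, c) ∈ μ → (put F i j 0 0 c = 0 ↔ c < l 0 + 1) := by
    intro i j F h hu hl
    obtain ⟨rfl, rfl⟩ := h.final hu hl
    refine ⟨⟨0, Nat.zero_le _, fun k => unslide_put _ _ _ _ _ _ _⟩, h.mem, ?_⟩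
    intro c hc
    by_cases hcl : c = l 0
    · rw [hcl, put_same]
      simp
    · rw [put_ne _ _ (by omega), h.zero c hc (by omega)]
      omega
  induction i, j, F using slide.induct with
  | case1 F =>
    rw [slide]
    exact halt _ _ _ h (by omega) (by omega)
  | case2 j F h0 =>
    rw [slide, if_pos h0]
    refine halt _ _ _ h (by omega) ?_
    intro m hm
    obtain rfl : j = m := by omega
    exact h0
  | case3 j F h0 ih =>
    rw [slide, if_neg h0]
    obtain ⟨⟨d, h1, h2⟩, h3⟩ := ih (h.left h0 (by omega))
    refine ⟨⟨d + 1, by omega, fun k => ?_⟩, h3⟩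
    rw [show k + (d + 1) = k + 1 + d by omega, h2, unslide_left h]
  | case4 i F h0 =>
    rw [slide, if_pos h0]
    refine halt _ _ _ h ?_ (by omega)
    intro m hm
    obtain rfl : i = m := by omega
    exact h0
  | case5 i F h0 ih =>
    rw [slide, if_neg h0]
    obtain ⟨⟨d, h1, h2⟩, h3⟩ := ih (h.up h0 (by omega))
    refine ⟨⟨d + 1, by omega, fun k => ?_⟩, h3⟩
    rw [show k + (d + 1) = k + 1 + d by omega, h2, unslide_up h]
  | case6 i j F h0 =>
    rw [slide, if_pos h0]
    refine halt _ _ _ h ?_ ?_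
    · intro m hm
      obtain rfl : i = m := by omega
      exact h0.1
    · intro m hm
      obtain rfl : j = m := by omega
      exact h0.2
  | case7 i j F h0 h1 ih =>
    rw [slide, if_neg h0, if_pos h1]
    have hne : F i (j + 1) ≠ 0 := by omega
    obtain ⟨⟨d, h1, h2⟩, h3⟩ := ih (h.up hne (by
      intro m hm
      obtain rfl : j = m := by omega
      exact h1))
    refine ⟨⟨d + 1, by omega, fun k => ?_⟩, h3⟩
    rw [show k + (d + 1) = k + 1 + d by omega, h2, unslide_up h]
  | case8 i j F h0 h1 ih =>
    rw [slide, if_neg h0, if_neg h1]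
    have hne : F (i + 1) j ≠ 0 := by omega
    obtain ⟨⟨d, h1, h2⟩, h3⟩ := ih (h.left hne (by
      intro m hm
      obtain rfl : i = m := by omega
      exact not_le.1 h1))
    refine ⟨⟨d + 1, by omega, fun k => ?_⟩, h3⟩
    rw [show k + (d + 1) = k + 1 + d by omega, h2, unslide_left h]

/-- The state before the slide that starts in column `q`. -/
theorem ColsInv.hole {n : ℕ} {μ : YoungDiagram} {T : SST n μ} {q : ℕ} {F : ℕ → ℕ → ℕ}
    {l : ℕ → ℕ} (h : ColsInv μ n q T.entry F l) (hq : q < μ.rowLen 0)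
    (hn : T.entry (μ.colLen q - 1) q = n) : HoleInv μ n q (μ.colLen q - 1) q l F := by
  have hmem := bottom_mem hq
  have hbot : ∀ r, (r, q) ∈ μ → r ≤ μ.colLen q - 1 := by
    intro r hr
    have := YoungDiagram.mem_iff_lt_colLen.1 hr
    omega
  refine ⟨hmem, le_rfl, ?_, ?_, ?_, ?_, ?_, ?_, ?_, ?_⟩
  · intro r c c' h1 h2 _ _
    exact h.row r c c' h1 h2
  · intro r r' c h1 h2 _ _
    exact h.col r r' c h1 h2
  · intro r c h1 _
    exact lt_of_le_of_lt (Nat.zero_le _) (h.col 0 (r + 1) c (by omega) h1)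
  · intro r c h1 h2 h3
    rcases Nat.lt_or_ge c q with h4 | h4
    · exact h.lt r c h1 h4
    · obtain rfl : c = q := by omega
      rw [h.same r c le_rfl]
      have h5 := hbot r h1
      have h6 : T.entry r c < T.entry (μ.colLen c - 1) c := T.1.col_strict (by omega) hmem
      omega
  · intro c h1 _
    exact h.zero c h1
  · intro r s h1 h2
    exact h.mono r s h1 (μ.up_left_mem h2 le_rfl hmem)
  · exact h.le _ hmem
  · intro r m h1 h2 h3
    exact h.bar r m (μ.up_left_mem (by omega) le_rfl hmem) h2 h3

/-- The number of zeros in the top row. -/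
def zeros (μ : YoungDiagram) (F : ℕ → ℕ → ℕ) : ℕ :=
  ((Finset.range (μ.rowLen 0)).filter (fun c => F 0 c = 0)).card

theorem zeros_eq {μ : YoungDiagram} {F : ℕ → ℕ → ℕ} {m : ℕ}
    (hm : m ≤ μ.rowLen 0) (h : ∀ c, (0, c) ∈ μ → (F 0 c = 0 ↔ c < m)) : zeros μ F = m := by
  have h1 : (Finset.range (μ.rowLen 0)).filter (fun c => F 0 c = 0) = Finset.range m := by
    ext c
    rw [Finset.mem_filter, Finset.mem_range, Finset.mem_range]
    constructor
    · rintro ⟨h1, h2⟩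
      exact (h c (YoungDiagram.mem_iff_lt_rowLen.2 h1)).1 h2
    · intro h1
      exact ⟨by omega, (h c (YoungDiagram.mem_iff_lt_rowLen.2 (by omega))).2 h1⟩
  rw [zeros, h1, Finset.card_range]

/-- The inverse slide of the last dot at rest. -/
def unslideLast (μ : YoungDiagram) (n : ℕ) (F : ℕ → ℕ → ℕ) : ℕ → ℕ → ℕ :=
  unslide μ n (μ.colLen 0 + μ.rowLen 0) 0 (zeros μ F - 1) F

theorem unslideLast_slideCols {n : ℕ} {μ : YoungDiagram} (T : SST n μ) {q : ℕ}
    (hq : q < μ.rowLen 0) (hn : T.entry (μ.colLen q - 1) q = n) :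
    zeros μ (slideCols μ n T.entry (q + 1)) = zeros μ (slideCols μ n T.entry q) + 1 ∧
    unslideLast μ n (slideCols μ n T.entry (q + 1)) = slideCols μ n T.entry q := by
  obtain ⟨l, hl⟩ := slideCols_inv T q hq.le
  have hmem := bottom_mem hq
  obtain ⟨⟨d, h1, h2⟩, h3, h4⟩ := unslide_slide _ _ _ _ (hl.hole hq hn)
  have h5 := YoungDiagram.mem_iff_lt_rowLen.1 h3
  have z1 := zeros_eq h5.le hl.zero
  have z2 := zeros_eq (μ := μ) (by omega) h4
  have e : slideCols μ n T.entry (q + 1) =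
      slide (μ.colLen q - 1) q (slideCols μ n T.entry q) := by
    rw [slideCols, if_pos hn]
  rw [e]
  refine ⟨by rw [z1, z2], ?_⟩
  -- The slide makes d ≤ i + j moves, so the fuel colLen + rowLen covers them; k is what remains.
  have h6 := (SST.mem_iff.1 hmem).1
  obtain ⟨k, hk⟩ : ∃ k, μ.colLen 0 + μ.rowLen 0 = k + d :=
    ⟨μ.colLen 0 + μ.rowLen 0 - d, by omega⟩
  rw [unslideLast, z2, hk, Nat.add_sub_cancel, h2]
  have h7 : slideCols μ n T.entry q (μ.colLen q - 1) q = n := by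
    rw [slideCols_same T hq.le le_rfl, hn]
  have h8 : put (slideCols μ n T.entry q) (μ.colLen q - 1) q n = slideCols μ n T.entry q := by
    have := put_self (slideCols μ n T.entry q) (μ.colLen q - 1) q
    rwa [h7] at this
  cases k with
  | zero => rw [unslide, h8]
  | succ k =>
    -- Back at its origin the dot halts despite spare fuel: there is no box below the bottom of the
    -- column, and a letter to the right of an `n` is not smaller than `n`.
    rw [unslide, if_neg, if_neg, h8]
    · rintro ⟨k1, k2⟩
      rw [slideCols_same T hq.le (show q ≤ q + 1 by omega)] at k2
      have := T.entry_mono (show q ≤ q + 1 by omega) k1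
      omega
    · rintro ⟨k1, -⟩
      have := YoungDiagram.mem_iff_lt_colLen.1 k1
      omega

/-- The number of inverse slides is read off from the zeros of the filling. So the original tableau
is a function of the final filling alone. -/
theorem iterate_unslideLast {n : ℕ} {μ : YoungDiagram} (T : SST n μ) {q : ℕ}
    (hq : q ≤ μ.rowLen 0) :
    (unslideLast μ n)^[zeros μ (slideCols μ n T.entry q)] (slideCols μ n T.entry q) =
      T.entry := by
  induction q with
  | zero =>
    have h : zeros μ (slideCols μ n T.entry 0) = 0 := by
      apply zeros_eq (Nat.zero_le _)
      intro c hc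
      have : 1 ≤ T.entry 0 c := (T.2 0 c hc).1
      simp only [slideCols]
      omega
    rw [h]
    rfl
  | succ q ih =>
    by_cases hn : T.entry (μ.colLen q - 1) q = n
    · obtain ⟨h1, h2⟩ := unslideLast_slideCols T hq hn
      rw [h1, Function.iterate_succ_apply, h2]
      exact ih (by omega)
    · rw [slideCols, if_neg hn]
      exact ih (by omega)

end Promotion

/-! ### Promotion on tableaux: injectivity and contents. -/

namespace SST
open Promotion

theorem entry_pr {n : ℕ} {μ : YoungDiagram} (T : SST n μ) {r c : ℕ} (h : (r, c) ∈ μ) :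
    (pr T).entry r c = slideCols μ n T.entry (μ.rowLen 0) r c + 1 := by
  change fill μ n T.entry r c = _
  rw [fill, if_pos h]

theorem pr_injective {n : ℕ} {μ : YoungDiagram} : Function.Injective (pr (n := n) (μ := μ)) := by
  intro T T' h
  have h1 : slideCols μ n T.entry (μ.rowLen 0) = slideCols μ n T'.entry (μ.rowLen 0) := by
    funext r c
    by_cases hm : (r, c) ∈ μ
    · have h2 := entry_pr T hm
      rw [h, entry_pr T' hm] at h2
      omega
    · rw [slideCols_of_not_mem T le_rfl hm, slideCols_of_not_mem T' le_rfl hm]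
  have h2 := iterate_unslideLast T le_rfl
  rw [h1, iterate_unslideLast T' le_rfl] at h2
  apply ext_entry
  intro i j _
  rw [h2]

theorem mult_pr_succ {n : ℕ} {μ : YoungDiagram} (T : SST n μ) (v : ℕ) :
    (pr T).mult (v + 1) = cnt μ (slideCols μ n T.entry (μ.rowLen 0)) v := by
  rw [mult, cnt]
  congr 1
  apply Finset.filter_congr
  rintro ⟨r, c⟩ hc
  rw [entry_pr T ((YoungDiagram.mem_cells _).1 hc), Nat.add_right_cancel_iff]

theorem mult_pr_of_pos {n : ℕ} {μ : YoungDiagram} (T : SST n μ) {v : ℕ} (h : 0 < v)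
    (hn : v < n) : (pr T).mult (v + 1) = T.mult v := by
  rw [mult_pr_succ, (cnt_slideCols (by omega) T le_rfl).1 v (by omega) (by omega)]
  rfl

theorem mult_pr_one {n : ℕ} {μ : YoungDiagram} (hn : 0 < n) (T : SST n μ) :
    (pr T).mult 1 = T.mult n := by
  have h1 := (cnt_slideCols hn T le_rfl).2
  have h2 : cnt μ T.entry 0 = 0 := by
    rw [cnt, Finset.card_eq_zero, Finset.filter_eq_empty_iff]
    rintro ⟨r, c⟩ hc
    have : 1 ≤ T.entry r c := (T.2 r c ((YoungDiagram.mem_cells _).1 hc)).1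
    simp only
    omega
  have h3 : cnt μ (slideCols μ n T.entry (μ.rowLen 0)) n = 0 := by
    rw [cnt, Finset.card_eq_zero, Finset.filter_eq_empty_iff]
    rintro ⟨r, c⟩ hc
    have hm := (YoungDiagram.mem_cells _).1 hc
    obtain ⟨l, hl⟩ := slideCols_inv T (μ.rowLen 0) le_rfl
    have := hl.lt r c hm (YoungDiagram.mem_iff_lt_rowLen.1
      (μ.up_left_mem (Nat.zero_le r) le_rfl hm))
    simp only
    omega
  rw [mult_pr_succ (v := 0)]
  change _ = cnt μ T.entry n
  omega

end SST

/-! ## Coxeter elements -/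

namespace Coxeter

variable {M : Type*} [Monoid M]

/-- The product `s₀ s₁ ⋯ sₘ₋₁`. -/
def asc (s : ℕ → M) : ℕ → M
  | 0 => 1
  | m + 1 => asc s m * s m

/-- The product `sₘ₋₁ sₘ₋₂ ⋯ sₘ₋ₖ`. -/
def desc (s : ℕ → M) : ℕ → ℕ → M
  | _, 0 => 1
  | 0, _ + 1 => 1
  | m + 1, k + 1 => s m * desc s m k

/-- The Coxeter relations of the symmetric group on `m + 1` letters. -/
structure Relations (s : ℕ → M) (m : ℕ) : Prop where
  sq : ∀ i, i < m → s i * s i = 1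
  comm : ∀ i j, i + 1 < j → j < m → s i * s j = s j * s i
  braid : ∀ i, i + 1 < m → s i * s (i + 1) * s i = s (i + 1) * s i * s (i + 1)

variable {s : ℕ → M} {m : ℕ}

theorem Relations.mono (h : Relations s m) {k : ℕ} (hk : k ≤ m) : Relations s k where
  sq i hi := h.sq i (by omega)
  comm i j hi hj := h.comm i j hi (by omega)
  braid i hi := h.braid i (by omega)

theorem Relations.asc_comm (h : Relations s m) {k j : ℕ} (hk : k < j) (hj : j < m) :
    asc s k * s j = s j * asc s k := by
  induction k with
  | zero => simp [asc]
  | succ k ih =>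
    rw [asc, mul_assoc, h.comm k j hk hj, ← mul_assoc, ih (by omega), mul_assoc]

/-- Conjugation by the Coxeter element shifts the generators. The braid relation enters where `s i *
s (i + 1)` stands in the product; the remaining factors commute. -/
theorem Relations.mul_asc (h : Relations s m) {i : ℕ} (hi : i + 1 < m) :
    s (i + 1) * asc s m = asc s m * s i := by
  induction m with
  | zero => omega
  | succ m ih =>
    rcases Nat.lt_or_ge (i + 1) m with h1 | h1
    · rw [asc, ← mul_assoc, ih (h.mono (Nat.le_succ m)) h1, mul_assoc, mul_assoc,
        h.comm i m h1 (Nat.lt_succ_self m)]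
    · obtain rfl : m = i + 1 := by omega
      rw [asc, asc, ← mul_assoc, ← mul_assoc, ← h.asc_comm (Nat.lt_succ_self i) hi,
        mul_assoc, mul_assoc, ← mul_assoc (s (i + 1)), ← h.braid i hi]
      simp only [mul_assoc]

theorem Relations.desc_mul_asc_succ (h : Relations s (m + 1)) {k j : ℕ} (hk : k ≤ j)
    (hj : j ≤ m) : desc s (j + 1) k * asc s (m + 1) = asc s (m + 1) * desc s j k := by
  induction k generalizing j with
  | zero => simp [desc]
  | succ k ih =>
    obtain ⟨j, rfl⟩ : ∃ i, j = i + 1 := ⟨j - 1, by omega⟩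
    rw [desc, mul_assoc, ih (by omega) (by omega), ← mul_assoc, h.mul_asc (by omega), desc,
      mul_assoc]

/-- Moving a new factor of the Coxeter element past the descending product lowers its indices by
one, leaving room for a new leading `s m`. For k = m + 1 this reduces the power to the smaller
group. -/
theorem Relations.asc_pow (h : Relations s (m + 1)) {k : ℕ} (hk : k ≤ m + 1) :
    asc s (m + 1) ^ k = asc s m ^ k * desc s (m + 1) k := by
  induction k with
  | zero => simp [desc]
  | succ k ih =>
    rw [pow_succ, ih (by omega), mul_assoc, h.desc_mul_asc_succ (by omega) le_rfl, asc, desc,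
      pow_succ]
    simp only [mul_assoc]

theorem Relations.desc_mul_asc (h : Relations s m) : desc s m m * asc s m = 1 := by
  induction m with
  | zero => simp [desc, asc]
  | succ m ih =>
    rw [desc, asc, mul_assoc, ← mul_assoc (desc s m m), ih (h.mono (Nat.le_succ m)), one_mul,
      h.sq m (Nat.lt_succ_self m)]

/-- The `(m + 1)`-st power of the Coxeter element of the symmetric group on `m + 1` letters. -/
theorem Relations.asc_pow_succ (h : Relations s m) : asc s m ^ (m + 1) = 1 := by
  induction m with
  | zero => simp [asc]
  | succ m ih =>
    rw [pow_succ, h.asc_pow le_rfl, ih (h.mono (Nat.le_succ m)), one_mul, h.desc_mul_asc]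

end Coxeter

/-! ## Orbits of commuting maps -/

open Function in
/-- Let `p` and `c` rotate an invariant `κ` with values of period exactly `n`, and let `cⁿ` be the
identity. Then the orbit of `x` under `p` has as many elements as `{cᵃ pᵇⁿ x}`. -/
theorem ncard_orbit_eq_of_rotation {X K : Type*} [Finite X] {p c : X → X} {n : ℕ} (hn : 0 < n)
    (hp : Injective p) (hc : ∀ x, c^[n] x = x) (κ : X → K) (ρ : K → K)
    (hκp : ∀ x, κ (p x) = ρ (κ x)) (hκc : ∀ x, κ (c x) = ρ (κ x))
    (hρ : ∀ x k, ρ^[k] (κ x) = κ x ↔ n ∣ k) (x : X) :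
    {y | ∃ k : ℕ, y = p^[k] x}.ncard = {y | ∃ a b : ℕ, y = c^[a] (p^[b * n] x)}.ncard := by
  have hκp' : ∀ k x, κ (p^[k] x) = ρ^[k] (κ x) := fun k x =>
    Semiconj.iterate_right (f := κ) (ga := p) (gb := ρ) hκp k x
  have hκc' : ∀ k x, κ (c^[k] x) = ρ^[k] (κ x) := fun k x =>
    Semiconj.iterate_right (f := κ) (ga := c) (gb := ρ) hκc k x
  have hcinj : Injective c := by
    intro u v huv
    obtain ⟨m, rfl⟩ : ∃ m, n = m + 1 := ⟨n - 1, by omega⟩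
    have h1 := hc u
    rw [iterate_succ_apply, huv, ← iterate_succ_apply, hc v] at h1
    exact h1.symm
  set N := minimalPeriod p x with hN
  have hNpos : 0 < N := minimalPeriod_pos_of_mem_periodicPts (hp.mem_periodicPts x)
  -- Returning to `x` returns the invariant to itself, which needs a multiple of n steps.
  have hdvd : n ∣ N := by
    rw [← hρ x, ← hκp', hN, iterate_minimalPeriod]
  obtain ⟨e, he⟩ := hdvd
  have hinj := iterate_injOn_Iio_minimalPeriod (f := p) (x := x)
  rw [← hN] at hinj
  have hlt : ∀ b, b < e → b * n < N := by
    intro b hb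
    rw [he, Nat.mul_comm]
    exact Nat.mul_lt_mul_of_pos_left hb hn
  have h1 : {y | ∃ k : ℕ, y = p^[k] x} = (fun k => p^[k] x) '' Set.Iio N := by
    ext y
    constructor
    · rintro ⟨k, rfl⟩
      exact ⟨k % N, Nat.mod_lt _ hNpos, iterate_mod_minimalPeriod_eq⟩
    · rintro ⟨k, -, rfl⟩
      exact ⟨k, rfl⟩
  have h2 : {y | ∃ a b : ℕ, y = c^[a] (p^[b * n] x)} =
      (fun k : ℕ × ℕ => c^[k.1] (p^[k.2 * n] x)) '' (Set.Iio n ×ˢ Set.Iio e) := by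
    have he0 : 0 < e := Nat.pos_of_ne_zero (by rintro rfl; omega)
    ext y
    constructor
    · rintro ⟨a, b, rfl⟩
      refine ⟨(a % n, b % e), ⟨Nat.mod_lt _ hn, Nat.mod_lt _ he0⟩, ?_⟩
      have e1 : b % e * n = b * n % N := by
        rw [he, Nat.mul_comm n e, Nat.mul_mod_mul_right]
      simp only
      rw [e1, iterate_mod_minimalPeriod_eq,
        IsPeriodicPt.iterate_mod_apply (show IsPeriodicPt c n _ from hc _)]
    · rintro ⟨k, -, rfl⟩
      exact ⟨k.1, k.2, rfl⟩
  have hκ0 : ∀ b, κ (p^[b * n] x) = κ x := by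
    intro b
    rw [hκp', hρ]
    exact Nat.dvd_mul_left n b
  -- Cancel cᵃ by injectivity. The powers of pⁿ leave κ fixed at κ(x), so the remaining exponent a'
  -- - a < n is a multiple of n.
  have key : ∀ a a' b b', a ≤ a' → a' < n → c^[a] (p^[b * n] x) = c^[a'] (p^[b' * n] x) →
      a = a' := by
    intro a a' b b' haa ha h
    obtain ⟨d, rfl⟩ := Nat.exists_eq_add_of_le haa
    rw [iterate_add_apply] at h
    have h3 := congrArg κ (hcinj.iterate a h)
    rw [hκc', hκ0, hκ0] at h3
    have h4 := Nat.eq_zero_of_dvd_of_lt ((hρ x d).1 h3.symm) (by omega)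
    omega
  have hinj2 : Set.InjOn (fun k : ℕ × ℕ => c^[k.1] (p^[k.2 * n] x))
      (Set.Iio n ×ˢ Set.Iio e) := by
    rintro ⟨a, b⟩ ⟨ha, hb⟩ ⟨a', b'⟩ ⟨ha', hb'⟩ h
    simp only [Set.mem_Iio] at ha hb ha' hb' h
    have haa : a = a' := by
      rcases le_total a a' with h3 | h3
      · exact key a a' b b' h3 ha' h
      · exact (key a' a b' b h3 ha h.symm).symm
    subst haa
    have h4 := hinj (hlt b hb) (hlt b' hb') (hcinj.iterate a h)
    rw [Nat.eq_of_mul_eq_mul_right hn h4]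
  rw [h1, h2, hinj.ncard_image, hinj2.ncard_image, Set.ncard_prod, he]
  simp [Set.ncard_eq_toFinset_card']

/-- A function on the integers with periods `n` and `k`, whose sum over `n` consecutive integers
is prime to `n`, forces `n ∣ k`. -/
theorem dvd_of_periodic_of_coprime_sum {f : ℤ → ℕ} {n k : ℕ} (hn : Function.Periodic f n)
    (hk : Function.Periodic f k)
    (h : Nat.Coprime n (∑ j ∈ Finset.range n, f j)) : n ∣ k := by
  set d := Nat.gcd n k with hd
  -- The gcd is a period by Bézout, which is why `f` is defined on the integers. With e = n/d, the
  -- sum over n terms is e times the sum over d terms, so e divides both coprime numbers.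
  have hfd : Function.Periodic f d := by
    rw [hd, Nat.gcd_eq_gcd_ab]
    have h1 := (hn.int_mul (Nat.gcdA n k)).add_period (hk.int_mul (Nat.gcdB n k))
    rwa [mul_comm, mul_comm (k : ℤ)]
  obtain ⟨e, he⟩ : d ∣ n := Nat.gcd_dvd_left n k
  have hsum : ∀ e : ℕ, ∑ j ∈ Finset.range (d * e), f j = e * ∑ j ∈ Finset.range d, f j := by
    intro e
    induction e with
    | zero => simp
    | succ e ih =>
      rw [Nat.mul_succ, Finset.sum_range_add, ih, Nat.succ_mul]
      congr 1
      apply Finset.sum_congr rfl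
      intro j _
      have := (hfd.nat_mul e) j
      rw [← this]
      congr 1
      push_cast
      ring
  have h1 : e ∣ Nat.gcd n (∑ j ∈ Finset.range n, f j) := by
    apply Nat.dvd_gcd
    · exact ⟨d, by rw [he, Nat.mul_comm]⟩
    · rw [he, hsum]
      exact Nat.dvd_mul_right _ _
  rw [h, Nat.dvd_one] at h1
  rw [h1, Nat.mul_one] at he
  rw [he]
  exact Nat.gcd_dvd_right n k

/-! ## The action on tableaux -/

namespace SST
open CrystalWord

variable {n : ℕ} {μ : YoungDiagram}

theorem sTilde_sTilde {i : ℕ} (hi : 1 ≤ i) (hn : i < n) (T : SST n μ) :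
    sTilde i (sTilde i T) = T := by
  apply word_injective
  rw [word_sTilde hi hn, word_sTilde hi hn, reflect_reflect]

theorem sTilde_comm {i j : ℕ} (hi : 1 ≤ i) (hij : i + 1 < j) (hn : j < n) (T : SST n μ) :
    sTilde i (sTilde j T) = sTilde j (sTilde i T) := by
  apply word_injective
  rw [word_sTilde hi (by omega), word_sTilde (by omega) hn, word_sTilde (by omega) hn,
    word_sTilde hi (by omega), reflect_comm (Or.inl hij)]

theorem sTilde_braid {i : ℕ} (hi : 1 ≤ i) (hn : i + 1 < n) (T : SST n μ) :
    sTilde i (sTilde (i + 1) (sTilde i T)) =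
      sTilde (i + 1) (sTilde i (sTilde (i + 1) T)) := by
  have h1 : ∀ T : SST n μ, (sTilde i T).word = reflect i T.word := word_sTilde hi (by omega)
  have h2 : ∀ T : SST n μ, (sTilde (i + 1) T).word = reflect (i + 1) T.word :=
    word_sTilde (by omega) hn
  apply word_injective
  rw [h1, h2, h1, h2, h1, h2, reflect_braid]

theorem mult_sTilde_self {i : ℕ} (hi : 1 ≤ i) (hn : i < n) (T : SST n μ) :
    (sTilde i T).mult i = T.mult (i + 1) := by
  rw [← count_word, ← count_word, word_sTilde hi hn, count_reflect_self]

theorem mult_sTilde_succ {i : ℕ} (hi : 1 ≤ i) (hn : i < n) (T : SST n μ) :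
    (sTilde i T).mult (i + 1) = T.mult i := by
  rw [← count_word, ← count_word, word_sTilde hi hn, count_reflect_succ]

theorem mult_sTilde_of_ne {i v : ℕ} (hi : 1 ≤ i) (hn : i < n) (h : v ≠ i) (h' : v ≠ i + 1)
    (T : SST n μ) : (sTilde i T).mult v = T.mult v := by
  rw [← count_word, ← count_word, word_sTilde hi hn, count_reflect_of_ne _ _ h h']

/-- The simple reflections in the monoid of self-maps, numbered from `0`. -/
noncomputable def sEnd (n : ℕ) (μ : YoungDiagram) (k : ℕ) : Function.End (SST n μ) :=
  sTilde (k + 1)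

theorem sEnd_relations (n : ℕ) (μ : YoungDiagram) :
    Coxeter.Relations (sEnd n μ) (n - 1) where
  sq i hi := funext fun T => sTilde_sTilde (Nat.succ_pos i) (by omega) T
  comm i j hij hj := funext fun T =>
    sTilde_comm (Nat.succ_pos i) (show i + 1 + 1 < j + 1 by omega) (by omega) T
  braid i hi := funext fun T => sTilde_braid (Nat.succ_pos i) (by omega) T

theorem cTilde_eq_asc (n : ℕ) (μ : YoungDiagram) :
    cTilde n μ = Coxeter.asc (sEnd n μ) (n - 1) := by
  have h : ∀ (m : ℕ) (g : SST n μ → SST n μ),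
      ((List.range m).map (fun k => sTilde (n := n) (μ := μ) (k + 1))).foldr
        (fun s g => s ∘ g) g = (Coxeter.asc (sEnd n μ) m : Function.End (SST n μ)) ∘ g := by
    intro m
    induction m with
    | zero => intro g; rfl
    | succ m ih =>
      intro g
      rw [List.range_succ, List.map_append, List.foldr_append, ih]
      rfl
  exact h (n - 1) id

theorem end_pow_apply {X : Type*} (f : Function.End X) (k : ℕ) (x : X) :
    (f ^ k) x = f^[k] x := by
  induction k generalizing x with
  | zero => rfl
  | succ k ih =>
    rw [pow_succ]
    exact ih (f x)

theorem iterate_cTilde (hn : 0 < n) (T : SST n μ) : (cTilde n μ)^[n] T = T := by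
  rw [cTilde_eq_asc, ← end_pow_apply]
  have h := (sEnd_relations n μ).asc_pow_succ
  rw [Nat.sub_add_cancel hn] at h
  rw [h]
  rfl

/-- Each factor is an adjacent transposition of multiplicities. The last generator is applied first
and carries the multiplicity of `m + 1` one place down; the shorter product carries it on to the
first place. -/
theorem mult_asc {m : ℕ} (hm : m < n) (T : SST n μ) :
    (Coxeter.asc (sEnd n μ) m T).mult 1 = T.mult (m + 1) ∧
    (∀ v, 0 < v → v ≤ m → (Coxeter.asc (sEnd n μ) m T).mult (v + 1) = T.mult v) ∧
    ∀ v, m + 1 < v → (Coxeter.asc (sEnd n μ) m T).mult v = T.mult v := by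
  induction m generalizing T with
  | zero => exact ⟨rfl, fun v h1 h2 => by omega, fun _ _ => rfl⟩
  | succ m ih =>
    obtain ⟨h1, h2, h3⟩ := ih (by omega) (sTilde (m + 1) T)
    have hs : 1 ≤ m + 1 := Nat.succ_pos m
    change (Coxeter.asc (sEnd n μ) m (sTilde (m + 1) T)).mult 1 = _ ∧
      (∀ v, 0 < v → v ≤ m + 1 →
        (Coxeter.asc (sEnd n μ) m (sTilde (m + 1) T)).mult (v + 1) = T.mult v) ∧
      ∀ v, m + 1 + 1 < v → (Coxeter.asc (sEnd n μ) m (sTilde (m + 1) T)).mult v = T.mult v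
    refine ⟨?_, ?_, ?_⟩
    · rw [h1, mult_sTilde_self hs hm]
    · intro v k1 k2
      rcases Nat.eq_or_lt_of_le k2 with rfl | k3
      · rw [h3 _ (by omega), mult_sTilde_succ hs hm]
      · rw [h2 v k1 (by omega), mult_sTilde_of_ne hs hm (by omega) (by omega)]
    · intro v k1
      rw [h3 v (by omega), mult_sTilde_of_ne hs hm (by omega) (by omega)]

/-- The content as an `n`-periodic function on the integers. -/
def periodicCont (T : SST n μ) (z : ℤ) : ℕ := T.mult ((z % n).toNat + 1)

theorem periodicCont_periodic (T : SST n μ) : Function.Periodic T.periodicCont n := by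
  intro z
  simp [periodicCont]

theorem periodicCont_natCast (T : SST n μ) {j : ℕ} (hj : j < n) :
    T.periodicCont j = T.mult (j + 1) := by
  rw [periodicCont, Int.emod_eq_of_lt (by omega) (by omega), Int.toNat_natCast]

/-- The rotation of functions on the integers by one step. -/
def rotate (f : ℤ → ℕ) (z : ℤ) : ℕ := f (z - 1)

theorem iterate_rotate (f : ℤ → ℕ) (k : ℕ) (z : ℤ) : rotate^[k] f z = f (z - k) := by
  induction k generalizing z with
  | zero => simp
  | succ k ih =>
    rw [Function.iterate_succ_apply', rotate, ih]
    congr 1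
    push_cast
    ring

theorem periodicCont_eq_rotate (hn : 0 < n) {T T' : SST n μ} (h1 : T'.mult 1 = T.mult n)
    (h2 : ∀ v, 0 < v → v < n → T'.mult (v + 1) = T.mult v) :
    T'.periodicCont = rotate T.periodicCont := by
  funext z
  rw [rotate, periodicCont, periodicCont]
  have hn' : (0 : ℤ) < n := by omega
  have e1 := Int.emod_nonneg (z - 1) hn'.ne'
  have e2 := Int.emod_lt_of_pos (z - 1) hn'
  have e3 : z % n = ((z - 1) % n + 1) % n := by
    rw [Int.emod_add_emod, sub_add_cancel]
  -- The second case is the wrap-around, where the letter `n` becomes 1.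
  rcases lt_or_ge ((z - 1) % n + 1) (n : ℤ) with h | h
  · rw [e3, Int.emod_eq_of_lt (by omega) h, Int.toNat_add e1 (by omega)]
    exact h2 _ (Nat.succ_pos _) (by omega)
  · have e4 : (z - 1) % n + 1 = n := by omega
    rw [e3, e4, Int.emod_self]
    have e5 : ((z - 1) % n).toNat + 1 = n := by omega
    rw [e5]
    exact h1

theorem periodicCont_pr (hn : 0 < n) (T : SST n μ) :
    (pr T).periodicCont = rotate T.periodicCont :=
  periodicCont_eq_rotate hn (mult_pr_one hn T) fun _ h1 h2 => mult_pr_of_pos T h1 h2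

theorem periodicCont_cTilde (hn : 0 < n) (T : SST n μ) :
    (cTilde n μ T).periodicCont = rotate T.periodicCont := by
  obtain ⟨h1, h2, -⟩ := mult_asc (m := n - 1) (by omega) T
  rw [Nat.sub_add_cancel hn] at h1
  rw [cTilde_eq_asc]
  exact periodicCont_eq_rotate hn h1 fun v k1 k2 => h2 v k1 (by omega)

theorem sum_periodicCont (T : SST n μ) :
    ∑ j ∈ Finset.range n, T.periodicCont j = μ.card := by
  have h : ∀ c ∈ μ.cells, T.entry c.1 c.2 - 1 ∈ Finset.range n := by
    rintro ⟨r, c⟩ hc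
    have h1 := T.2 r c ((YoungDiagram.mem_cells _).1 hc)
    change 1 ≤ T.entry r c ∧ T.entry r c ≤ n at h1
    rw [Finset.mem_range]
    simp only
    omega
  rw [YoungDiagram.card, Finset.card_eq_sum_card_fiberwise h]
  apply Finset.sum_congr rfl
  intro j hj
  rw [periodicCont_natCast T (Finset.mem_range.1 hj), mult]
  congr 1
  apply Finset.filter_congr
  rintro ⟨r, c⟩ hc
  have h1 : 1 ≤ T.entry r c := (T.2 r c ((YoungDiagram.mem_cells _).1 hc)).1
  simp only
  omega

theorem iterate_rotate_periodicCont_iff (hgcd : Nat.gcd n μ.card = 1) (T : SST n μ) (k : ℕ) :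
    rotate^[k] T.periodicCont = T.periodicCont ↔ n ∣ k := by
  constructor
  · intro h
    apply dvd_of_periodic_of_coprime_sum T.periodicCont_periodic
    · intro z
      have h1 := congrFun h (z + k)
      rw [iterate_rotate, add_sub_cancel_right] at h1
      exact h1.symm
    · rw [sum_periodicCont]
      exact hgcd
  · rintro ⟨e, rfl⟩
    funext z
    rw [iterate_rotate]
    have h1 := T.periodicCont_periodic.nat_mul e
    have h2 := h1 (z - ((n * e : ℕ) : ℤ))
    rw [← h2]
    congr 1
    push_cast
    ring

/-! ### The order of promotion. -/

theorem sTilde_iterate_pr_comm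
    (hcomm : ∀ i : ℕ, 1 ≤ i → i < n → ∀ T : SST n μ,
      sTilde i (pr^[n] T) = pr^[n] (sTilde i T)) (k : ℕ) (T : SST n μ) {i : ℕ} (hi : 1 ≤ i)
    (hn : i < n) : sTilde i ((pr^[n])^[k] T) = (pr^[n])^[k] (sTilde i T) :=
  Function.Semiconj.iterate_right (f := sTilde i) (hcomm i hi hn) k T

theorem dvd_of_iterate_pr (hn : 0 < n) (hgcd : Nat.gcd n μ.card = 1) {T : SST n μ} {k : ℕ}
    (h : pr^[k] T = T) : n ∣ k := by
  rw [← iterate_rotate_periodicCont_iff hgcd T]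
  have h1 : (pr^[k] T).periodicCont = rotate^[k] T.periodicCont :=
    Function.Semiconj.iterate_right (f := periodicCont (n := n) (μ := μ)) (periodicCont_pr hn) k T
  rw [← h1, h]

/-- The tableau with all entries in row `r` equal to `r + 1`. -/
theorem nonempty_of_colLen_le (h : μ.colLen 0 ≤ n) : Nonempty (SST n μ) := by
  refine ⟨⟨⟨fun i j => if (i, j) ∈ μ then i + 1 else 0, ?_, ?_, ?_⟩, ?_⟩⟩
  · intro i j1 j2 hj hm
    have hm' : (i, j1) ∈ μ := μ.up_left_mem le_rfl hj.le hm
    simp [hm, hm']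
  · intro i1 i2 j hi hm
    have hm' : (i1, j) ∈ μ := μ.up_left_mem hi.le le_rfl hm
    simp [hm, hm', hi]
  · intro i j hm
    simp [hm]
  · intro i j hm
    change 1 ≤ (if (i, j) ∈ μ then i + 1 else 0) ∧ (if (i, j) ∈ μ then i + 1 else 0) ≤ n
    have := (mem_iff.1 hm).1
    rw [if_pos hm]
    omega

/-- A quantity which decreases when the content is sorted. -/
def weightSum (T : SST n μ) : ℕ := ∑ v ∈ Finset.range (n + 1), v * T.mult v

/-- Exchanging an ascent cᵢ < cᵢ₊₁ lowers the sum by cᵢ₊₁ - cᵢ, so bubble sorting terminates. -/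
theorem weightSum_sTilde_lt {i : ℕ} (hi : 1 ≤ i) (hn : i < n) (T : SST n μ)
    (h : T.mult i < T.mult (i + 1)) : (sTilde i T).weightSum < T.weightSum := by
  have h1 : i ∈ Finset.range (n + 1) := Finset.mem_range.2 (by omega)
  have h2 : i + 1 ∈ (Finset.range (n + 1)).erase i :=
    Finset.mem_erase.2 ⟨by omega, Finset.mem_range.2 (by omega)⟩
  have h3 : ∑ v ∈ ((Finset.range (n + 1)).erase i).erase (i + 1), v * (sTilde i T).mult v =
      ∑ v ∈ ((Finset.range (n + 1)).erase i).erase (i + 1), v * T.mult v := by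
    apply Finset.sum_congr rfl
    intro v hv
    simp only [Finset.mem_erase] at hv
    rw [mult_sTilde_of_ne hi hn hv.2.1 hv.1]
  rw [weightSum, weightSum, ← Finset.add_sum_erase _ _ h1, ← Finset.add_sum_erase _ _ h2,
    ← Finset.add_sum_erase _ (fun v => v * T.mult v) h1,
    ← Finset.add_sum_erase _ (fun v => v * T.mult v) h2, h3, mult_sTilde_self hi hn,
    mult_sTilde_succ hi hn]
  nlinarith

/-- If an iterate of `prⁿ` fixes the tableaux with weakly decreasing content, it fixes all. -/
theorem iterate_pr_eq_of_antitone
    (hcomm : ∀ i : ℕ, 1 ≤ i → i < n → ∀ T : SST n μ,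
      sTilde i (pr^[n] T) = pr^[n] (sTilde i T)) {k : ℕ}
    (h : ∀ T : SST n μ, Antitone T.cont → (pr^[n])^[k] T = T) (T : SST n μ) :
    (pr^[n])^[k] T = T := by
  induction hw : T.weightSum using Nat.strong_induction_on generalizing T with
  | _ w ih =>
    by_cases hT : Antitone T.cont
    · exact h T hT
    · obtain ⟨i, hi, hin, hlt⟩ : ∃ i, 1 ≤ i ∧ i < n ∧ T.mult i < T.mult (i + 1) := by
        by_contra hcon
        push Not at hcon
        apply hT
        have key : ∀ d a, 1 ≤ a → a + d ≤ n → T.mult (a + d) ≤ T.mult a := by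
          intro d
          induction d with
          | zero => intros; exact le_rfl
          | succ d ihd =>
            intro a h1 h2
            exact le_trans (hcon (a + d) (by omega) (by omega)) (ihd a h1 (by omega))
        intro a b hab
        have hab' : (a : ℕ) ≤ b := hab
        have hb := b.2
        have h1 := key (b - a) (a + 1) (by omega) (by omega)
        rw [show (a : ℕ) + 1 + (b - a) = b + 1 by omega] at h1
        exact h1
      subst hw
      have h1 := ih _ (weightSum_sTilde_lt hi hin T hlt) (sTilde i T) rfl
      rw [← sTilde_iterate_pr_comm hcomm k T hi hin] at h1
      -- The power fixes the better sorted tableau; applying the involution again brings the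
      -- statement back to `T`.
      have h2 := congrArg (sTilde i) h1
      rwa [sTilde_sTilde hi hin, sTilde_sTilde hi hin] at h2

theorem orderOn_spec (μ : YoungDiagram) (α : Fin n → ℕ) :
    0 < orderOn μ α ∧ ∀ T : SST n μ, T.cont = α → (pr^[n])^[orderOn μ α] T = T := by
  apply Nat.sInf_mem (s := {k : ℕ | 0 < k ∧ ∀ T : SST n μ, T.cont = α → (pr^[n])^[k] T = T})
  classical
  let e : Equiv.Perm (SST n μ) :=
    -- Finiteness makes prⁿ a permutation of finite order, so the infimum is taken over a nonempty
    -- set.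
    Equiv.ofBijective (pr^[n]) (Finite.injective_iff_bijective.1 (pr_injective.iterate n))
  refine ⟨orderOf e, orderOf_pos e, fun T _ => ?_⟩
  have h1 : (e ^ orderOf e) T = T := by
    rw [pow_orderOf_eq_one]
    rfl
  rw [← Equiv.Perm.iterate_eq_pow] at h1
  exact h1

theorem orderOn_dvd {α : Fin n → ℕ} {k : ℕ}
    (h : ∀ T : SST n μ, T.cont = α → (pr^[n])^[k] T = T) : orderOn μ α ∣ k := by
  obtain ⟨h1, h2⟩ := orderOn_spec μ α
  rw [Nat.dvd_iff_mod_eq_zero]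
  by_contra h3
  have h4 : orderOn μ α ≤ k % orderOn μ α := by
    apply Nat.sInf_le
    refine ⟨Nat.pos_of_ne_zero h3, fun T hT => ?_⟩
    have h5 : Function.IsPeriodicPt (pr^[n]) (orderOn μ α) T := h2 T hT
    rw [h5.iterate_mod_apply]
    exact h T hT
  exact absurd (Nat.mod_lt k h1) (by omega)

theorem mem_contPlus {T : SST n μ} (h : Antitone T.cont) : T.cont ∈ contPlus n μ := by
  classical
  simp only [contPlus, Finset.mem_filter, Finset.mem_image, Finset.mem_univ, true_and]
  exact ⟨⟨T, rfl⟩, h⟩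

end SST

theorem theorem4p5 (n : ℕ) (μ : YoungDiagram) (hlen : μ.colLen 0 < n)
    (hgcd : Nat.gcd n μ.card = 1)
    (hcomm : ∀ i : ℕ, 1 ≤ i → i < n → ∀ T : SST n μ,
      SST.sTilde i (SST.pr^[n] T) = SST.pr^[n] (SST.sTilde i T)) :
    (∀ T : SST n μ, (SST.orbitPr T).ncard = (SST.orbitCP T).ncard) ∧
    IsLeast {k : ℕ | 0 < k ∧ ∀ T : SST n μ, SST.pr^[k] T = T}
      (n * (SST.contPlus n μ).lcm (SST.orderOn μ)) := by
  have hn : 0 < n := by omega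
  refine ⟨fun T => ncard_orbit_eq_of_rotation hn SST.pr_injective (SST.iterate_cTilde hn)
    SST.periodicCont SST.rotate (SST.periodicCont_pr hn) (SST.periodicCont_cTilde hn)
    (SST.iterate_rotate_periodicCont_iff hgcd) T, ⟨?_, ?_⟩, ?_⟩
  · apply Nat.mul_pos hn
    apply Nat.pos_of_ne_zero
    rw [Ne, Finset.lcm_eq_zero_iff]
    rintro ⟨α, -, h⟩
    exact (SST.orderOn_spec μ α).1.ne' h
  · intro T
    rw [Function.iterate_mul]
    refine SST.iterate_pr_eq_of_antitone hcomm (fun T hT => ?_) T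
    obtain ⟨e, he⟩ := Finset.dvd_lcm (f := SST.orderOn μ) (SST.mem_contPlus hT)
    rw [he]
    have h : Function.IsPeriodicPt (SST.pr^[n]) (SST.orderOn μ T.cont) T :=
      (SST.orderOn_spec μ T.cont).2 T rfl
    exact h.mul_const e
  · rintro k ⟨hk, h⟩
    -- Divisibility by n is read off from one tableau, so one must exist; the bound on the number of
    -- rows provides it.
    obtain ⟨T⟩ := SST.nonempty_of_colLen_le hlen.le
    obtain ⟨j, rfl⟩ := SST.dvd_of_iterate_pr hn hgcd (h T)
    apply Nat.mul_le_mul_left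
    apply Nat.le_of_dvd (Nat.pos_of_mul_pos_left hk)
    apply Finset.lcm_dvd
    intro α _
    apply SST.orderOn_dvd
    intro T _
    rw [← Function.iterate_mul]
    exact h T
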